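/- For $\psi\in\mathbb R$ let $\sigma(\psi)=\begin{pmatrix}\cos\psi&-\sin\psi\\ \sin\psi&\cos\psi\end{pmatrix}$. A $\delta$-PHO is a Hamiltonian $$K(q,p)=\tfrac12\sum_{j=1}^2(p_j^2+q_j^2)+V(q),\qquad (q,p)\in\mathbb R^2\times\mathbb R^2,$$ where $V$ is a real homogeneous polynomial of degree $\delta$ in $q=(q_1,q_2)$ ($V=0$ is allowed). Let $D_{\xi,\eta}=\sum_{j=1}^2\left(\xi_j\frac{\partial}{\partial\eta_j}-\eta_j\frac{\partial}{\partial\xi_j}\right)$. A real formal power series $G(\xi,\eta)=\frac12\sum_j(\eta_j^2+\xi_j^2)+\sum_{k\ge3}G_k(\xi,\eta)$, with $G_k$ homogeneous of degree $k$, is a Birkhoff–Gustavson normal form (BGNF) of $K$ up to degree $\rho$ if $D_{\xi,\eta}G_k=0$ for $3\le k\le\rho$ and there is a real formal power series $W(q,\eta)=\sum_j q_j\eta_j+\sum_{k\ge3}W_k(q,\eta)$, with $W_k$ homogeneous of degree $k$, such that, for $3\le k\le\rho$, $W_k$ lies in the image under $D_{q,\eta}$ of the homogeneous polynomials of degree $k$,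 and $$G\left(\frac{\partial W}{\partial\eta},\eta\right)=K\left(q,\frac{\partial W}{\partial q}\right).$$ Two Hamiltonians share their BGNF up to degree $\rho$ if they have BGNFs up to degree $\rho$ whose homogeneous parts of every degree $\le\rho$ coincide. A Hamiltonian $K$ is separable in the Cartesian coordinates rotated by $\psi$ if, with $\tilde K(\tilde q,\tilde p)=K(\sigma(\psi)^{-1}\tilde q,\sigma(\psi)^{-1}\tilde p)$, the Hamilton–Jacobi equation $\tilde K(\tilde q,\partial S/\partial\tilde q)=E$ has, near every point of the plane, a complete integral in separated form, i.e. a $C^2$ family of solutions $S=S_1(\tilde q_1;a)+S_2(\tilde q_2;a)$ with energy $E=E(a)$, depending on $a$ in a non-empty open subset of $\mathbb R^2$, with $\det(\partial^2S/\partial\tilde q_i\partial a_j)\ne0$. It is separable within a rotation of Cartesian coordinates if this holds for some $\psi$. **Theorem.** Let $\delta\ge3$ be odd and let $K$ be a $\delta$-PHO with potential $V$. 1. $K$ shares its BGNF up to degree $2\delta-2$ with some $(2\delta-2)$-PHO if and only if $K$ is separable within a rotation of Cartesian coordinates. 2. In that case the $(2\delta-2)$-PHO sharing the BGNF with $K$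 up to degree $2\delta-2$ is unique. 3. This $(2\delta-2)$-PHO is separable in the Cartesian coordinates rotated by $\psi$ for every $\psi$ for which $K$ is, and its potential is nonzero if $V\ne0$. -/

import Mathlib

open scoped Matrix

noncomputable section

namespace PHO

/-- Indices of the phase-space variables: `Sum.inl j` is the position `q_j` (or `ξ_j`),
`Sum.inr j` is the momentum `p_j` (or `η_j`). -/
abbrev Idx : Type := Fin 2 ⊕ Fin 2

/-- Formal power series with real coefficients in the four phase-space variables. -/
abbrev Series : Type := MvPowerSeries Idx ℝ

/-- The isotropic harmonic oscillator `½ ∑ⱼ (pⱼ² + qⱼ²)`. -/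
def osc : MvPolynomial Idx ℝ :=
  MvPolynomial.C (1 / 2) *
    ∑ j : Fin 2, (MvPolynomial.X (Sum.inr j) ^ 2 + MvPolynomial.X (Sum.inl j) ^ 2)

/-- The Hamiltonian `½ ∑ⱼ (pⱼ² + qⱼ²) + V(q)`. -/
def pho (V : MvPolynomial (Fin 2) ℝ) : MvPolynomial Idx ℝ :=
  osc + MvPolynomial.rename Sum.inl V

/-! ### The Birkhoff-Gustavson normal form -/

/-- The homogeneous part of degree `k` of a power series. -/
def homPart (k : ℕ) (F : Series) : Series :=
  fun d => if d.degree = k then MvPowerSeries.coeff d F else 0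

/-- The operator `D = ∑ⱼ (ξⱼ ∂/∂ηⱼ - ηⱼ ∂/∂ξⱼ)`. -/
def oscD (F : Series) : Series :=
  ∑ j : Fin 2, (MvPowerSeries.X (Sum.inl j) * MvPowerSeries.pderiv ℝ (Sum.inr j) F
    - MvPowerSeries.X (Sum.inr j) * MvPowerSeries.pderiv ℝ (Sum.inl j) F)

/-- `G = ½ ∑ⱼ (ηⱼ² + ξⱼ²) + (terms of degree at least 3)`. -/
def IsOscPlusHigher (G : Series) : Prop :=
  homPart 0 G = 0 ∧ homPart 1 G = 0 ∧ homPart 2 G = (osc : Series)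

/-- `W = ∑ⱼ qⱼ ηⱼ + (terms of degree at least 3)`. -/
def IsNearIdentity (W : Series) : Prop :=
  homPart 0 W = 0 ∧ homPart 1 W = 0 ∧
    homPart 2 W = ∑ j : Fin 2, MvPowerSeries.X (Sum.inl j) * MvPowerSeries.X (Sum.inr j)

/-- `G(∂W/∂η, η) = K(q, ∂W/∂q)`: the canonical transformation with the second-type generating
function `W(q, η)` takes the Hamiltonian `K(q, p)` to `G(ξ, η)`. -/
def Transforms (W K G : Series) : Prop :=
  MvPowerSeries.subst
      (Sum.elim (fun j => MvPowerSeries.pderiv ℝ (Sum.inr j) W)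
        (fun j => MvPowerSeries.X (Sum.inr j)) : Idx → Series) G =
    MvPowerSeries.subst
      (Sum.elim (fun j => MvPowerSeries.X (Sum.inl j))
        (fun j => MvPowerSeries.pderiv ℝ (Sum.inl j) W) : Idx → Series) K

/-- `G` is a Birkhoff-Gustavson normal form of `K` up to degree `ρ`: the homogeneous parts
`G_k`, `3 ≤ k ≤ ρ`, lie in the kernel of `D`, and `G` is obtained from `K` through a generating
function `W` whose homogeneous parts `W_k`, `3 ≤ k ≤ ρ`, lie in the image under `D` of the
homogeneous polynomials of degree `k`. -/
def IsBGNF (ρ : ℕ) (K G : Series) : Prop :=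
  IsOscPlusHigher G ∧ (∀ k, 3 ≤ k → k ≤ ρ → oscD (homPart k G) = 0) ∧
    ∃ W : Series, IsNearIdentity W ∧
      (∀ k, 3 ≤ k → k ≤ ρ →
        ∃ P : MvPolynomial Idx ℝ, P.IsHomogeneous k ∧ oscD (P : Series) = homPart k W) ∧
      Transforms W K G

/-- `K` and `K'` share their Birkhoff-Gustavson normal form up to degree `ρ`. -/
def SharesBGNF (ρ : ℕ) (K K' : Series) : Prop :=
  ∃ G G' : Series, IsBGNF ρ K G ∧ IsBGNF ρ K' G' ∧ ∀ k ≤ ρ, homPart k G = homPart k G'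

/-! ### Separability of the Hamilton-Jacobi equation -/

/-- The Hamilton-Jacobi equation `H(q, ∂S/∂q) = E` is separable in the coordinates `q`: near every
point of the plane it has a complete integral in separated form
`S(q; a) = S₀(q₀; a) + S₁(q₁; a)`, that is, a `C²` family of solutions, with energy `E(a)`,
depending on two parameters `a = (a₀, a₁)` with `det (∂²S/∂qᵢ∂aⱼ) ≠ 0`. (The metric ball in
`Fin 2 → ℝ` is an open square.) -/
def IsHJSeparable (H : (Fin 2 → ℝ) → (Fin 2 → ℝ) → ℝ) : Prop :=
  ∀ q₀ : Fin 2 → ℝ, ∃ ε > 0, ∃ A : Set (Fin 2 → ℝ), IsOpen A ∧ A.Nonempty ∧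
    ∃ (S : Fin 2 → ℝ → (Fin 2 → ℝ) → ℝ) (E : (Fin 2 → ℝ) → ℝ),
      (∀ i, ContDiffOn ℝ 2 (fun z : ℝ × (Fin 2 → ℝ) => S i z.1 z.2)
        (Metric.ball (q₀ i) ε ×ˢ A)) ∧
      ∀ q ∈ Metric.ball q₀ ε, ∀ a ∈ A,
        H q (fun i => deriv (fun x => S i x a) (q i)) = E a ∧
        (Matrix.of fun i j : Fin 2 =>
          fderiv ℝ (fun b => deriv (fun x => S i x b) (q i)) a (Pi.single j 1)).det ≠ 0

/-- The rotation matrix `σ(ψ)`. -/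
def rot (ψ : ℝ) : Matrix (Fin 2) (Fin 2) ℝ :=
  !![Real.cos ψ, -Real.sin ψ; Real.sin ψ, Real.cos ψ]

/-- The system with polynomial Hamiltonian `K` is separable in the rotated Cartesian coordinates
`q̃ = σ(ψ) q`, `p̃ = σ(ψ) p`: in these coordinates the Hamiltonian is
`K(σ(ψ)⁻¹ q̃, σ(ψ)⁻¹ p̃)`. -/
def IsSeparableInRotated (ψ : ℝ) (K : MvPolynomial Idx ℝ) : Prop :=
  IsHJSeparable fun q p => MvPolynomial.eval (Sum.elim ((rot ψ)⁻¹ *ᵥ q) ((rot ψ)⁻¹ *ᵥ p)) K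

end PHO

end

/-! Write δ = N + 1 with N even, and let V and U have degrees N + 1 and 2N. With W = ∑ qⱼ ηⱼ + w and
G = osc + H, the defining equation becomes H(q + ∂w/∂η, η) = V + ½ (|∂w/∂q|² - |∂w/∂η|²) - D w
(`transforms_iff`). On homogeneous polynomials D is semisimple, and it is bijective in odd degree.
Hence, up to degree 2N, degree N + 1 only says that D u = V for the leading part u of w, and the
first part of H that can survive is the projection to ker D of ½ (|∂u/∂q|² - |∂u/∂η|²), in degree
2N. For U that part is the projection of U itself. Sharing the normal form therefore means that the
two projections agree (`sharesBGNF_iff`).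

In the coordinates q = x + y, η = -i (x - y), D is i times the difference of the degrees in x and y,
and the projection selects bidegree (N, N). The condition becomes the explicit identity
`PolarizedMatch` between polarizations (`homologicalMatch_iff`). Its restriction to x = y recovers
U, which gives uniqueness.

Necessity: polarizations are killed by the Cayley operator ∂²/∂x₀∂y₁ - ∂²/∂x₁∂y₀. Applied to the
right side of the identity, then differentiated once and restricted to x = y, it leaves a nonzero
multiple of the Wronskian of V₀₀ - V₁₁ and V₀₁ (`PolarizedMatch.wronskian`). The multiple is a sum
of squared binomials with signs, shown to be nonzero by comparison with a telescoping sum. So V₀₀ -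
V₁₁ and V₀₁ are linearly dependent, and a rotation kills the mixed derivative of V
(`exists_isSplit_of_linear_relation`).

Sufficiency: a split V is a combination of powers of two orthonormal linear forms. Orthogonality
removes the cross terms in the identity, and an explicit combination of 2N-th powers of the same
forms solves it, with coefficients that vanish only when those of V do
(`exists_polarizedMatch_of_isSplit`).

Finally, a separated solution of the Hamilton-Jacobi equation writes the potential as a sum of
one-variable functions, and conversely action integrals give a complete integral, so separability is
the vanishing of the mixed derivative (`isSeparableInRotated_pho_iff`). -/

open scoped Matrix

noncomputable section

namespace PHO

open MvPolynomial Finset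

/-! ### Chain rule for polynomial substitutions -/

section ChainRule

variable {σ R A : Type*} [Fintype σ] [CommSemiring R] [CommSemiring A] [Algebra R A]

/-- Chain rule for a derivation applied to a polynomial expression. -/
theorem derivation_aeval (d : Derivation R A A) (g : σ → A) (f : MvPolynomial σ R) :
    d (aeval g f) = ∑ j, aeval g (pderiv j f) * d (g j) := by
  classical
  induction f using MvPolynomial.induction_on with
  | C r => simp
  | add p q hp hq => simp [hp, hq, add_mul, Finset.sum_add_distrib]
  | mul_X p i hp =>
    simp only [map_mul, Derivation.leibniz, aeval_X, smul_eq_mul, hp, pderiv_X, map_add, add_mul,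
      Finset.sum_add_distrib, Finset.mul_sum]
    congr 1
    · rw [Finset.sum_eq_single i]
      · simp
      · intro j _ hj
        simp [hj.symm]
      · simp
    · exact Finset.sum_congr rfl fun j _ => by ring

end ChainRule

/-! ### The bigrading of polynomials in two sets of variables -/

section Bigrading

variable {K : Type*} [CommRing K]

/-- The bidegree `(1, 0)` of the first set of variables and `(0, 1)` of the second one. -/
def bidegree : Idx → ℕ × ℕ := Sum.elim (fun _ => (1, 0)) (fun _ => (0, 1))

/-- The component of bidegree `(a, b)`. -/
def bicomp (a b : ℕ) : MvPolynomial Idx K →ₗ[K] MvPolynomial Idx K :=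
  weightedHomogeneousComponent bidegree (a, b)

theorem weight_bidegree (d : Idx →₀ ℕ) :
    Finsupp.weight bidegree d =
      (d (Sum.inl 0) + d (Sum.inl 1), d (Sum.inr 0) + d (Sum.inr 1)) := by
  rw [Finsupp.weight_apply, Finsupp.sum_fintype _ _ (by simp)]
  ext <;> simp [bidegree]

theorem degree_idx (d : Idx →₀ ℕ) :
    d.degree = (d (Sum.inl 0) + d (Sum.inl 1)) + (d (Sum.inr 0) + d (Sum.inr 1)) := by
  rw [Finsupp.degree_eq_sum]
  simp

theorem coeff_bicomp (a b : ℕ) (F : MvPolynomial Idx K) (d : Idx →₀ ℕ) :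
    coeff d (bicomp a b F) =
      if Finsupp.weight bidegree d = (a, b) then coeff d F else 0 := by
  rw [bicomp, coeff_weightedHomogeneousComponent]

theorem sum_bicomp {n : ℕ} {F : MvPolynomial Idx K} (hF : F.IsHomogeneous n) :
    ∑ p ∈ antidiagonal n, bicomp p.1 p.2 F = F := by
  ext d
  rw [coeff_sum]
  simp only [coeff_bicomp]
  by_cases hd : d.degree = n
  · rw [Finset.sum_eq_single (Finsupp.weight bidegree d)]
    · simp
    · intro p _ hp
      rw [if_neg (fun h => hp h.symm)]
    · intro h
      refine absurd ?_ h
      rw [HasAntidiagonal.mem_antidiagonal, weight_bidegree, ← hd, degree_idx]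
  · rw [hF.coeff_eq_zero hd]
    simp

theorem pderiv_inl_bicomp_succ (j : Fin 2) (a b : ℕ) (F : MvPolynomial Idx K) :
    pderiv (Sum.inl j) (bicomp (a + 1) b F) = bicomp a b (pderiv (Sum.inl j) F) := by
  ext d
  simp only [coeff_pderiv, coeff_bicomp, map_add, Finsupp.weight_single, bidegree, Sum.elim_inl,
    one_smul, ite_mul, zero_mul]
  congr 1
  simp [Prod.ext_iff]

theorem pderiv_inl_bicomp_zero (j : Fin 2) (b : ℕ) (F : MvPolynomial Idx K) :
    pderiv (Sum.inl j) (bicomp 0 b F) = 0 := by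
  ext d
  simp only [coeff_pderiv, coeff_bicomp, map_add, Finsupp.weight_single, bidegree, Sum.elim_inl,
    one_smul, ite_mul, zero_mul, coeff_zero]
  rw [if_neg]
  simp [Prod.ext_iff]

theorem pderiv_inr_bicomp_succ (j : Fin 2) (a b : ℕ) (F : MvPolynomial Idx K) :
    pderiv (Sum.inr j) (bicomp a (b + 1) F) = bicomp a b (pderiv (Sum.inr j) F) := by
  ext d
  simp only [coeff_pderiv, coeff_bicomp, map_add, Finsupp.weight_single, bidegree, Sum.elim_inr,
    one_smul, ite_mul, zero_mul]
  congr 1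
  simp [Prod.ext_iff]

theorem pderiv_inr_bicomp_zero (j : Fin 2) (a : ℕ) (F : MvPolynomial Idx K) :
    pderiv (Sum.inr j) (bicomp a 0 F) = 0 := by
  ext d
  simp only [coeff_pderiv, coeff_bicomp, map_add, Finsupp.weight_single, bidegree, Sum.elim_inr,
    one_smul, ite_mul, zero_mul, coeff_zero]
  rw [if_neg]
  simp [Prod.ext_iff]

theorem map_bicomp {L : Type*} [CommRing L] (φ : K →+* L) (a b : ℕ) (F : MvPolynomial Idx K) :
    map φ (bicomp a b F) = bicomp a b (map φ F) := by
  ext d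
  simp only [coeff_map, coeff_bicomp]
  split_ifs <;> simp

theorem bicomp_mul_of_bihomogeneous {F G : MvPolynomial Idx K} {p q : ℕ × ℕ}
    (hF : F.IsWeightedHomogeneous bidegree p) (hG : G.IsWeightedHomogeneous bidegree q) (a b : ℕ) :
    bicomp a b (F * G) = if p + q = (a, b) then F * G else 0 := by
  rw [bicomp, weightedHomogeneousComponent_of_mem (m := (a, b)) (hF.mul hG)]
  simp only [eq_comm]

end Bigrading

/-! ### Polarization -/

section Polarization

variable {K : Type*} [CommRing K]

/-- The polynomial `f (x + y)`. -/
def addSubst : MvPolynomial (Fin 2) K →ₐ[K] MvPolynomial Idx K :=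
  aeval fun j => X (Sum.inl j) + X (Sum.inr j)

/-- The component of bidegree `(a, b)` of `f (x + y)`. -/
def pol (a b : ℕ) (f : MvPolynomial (Fin 2) K) : MvPolynomial Idx K := bicomp a b (addSubst f)

theorem pol_add (a b : ℕ) (f g : MvPolynomial (Fin 2) K) : pol a b (f + g) = pol a b f + pol a b g := by
  simp [pol]

theorem pol_C_mul (a b : ℕ) (c : K) (f : MvPolynomial (Fin 2) K) :
    pol a b (C c * f) = C c * pol a b f := by
  rw [← smul_eq_C_mul, ← smul_eq_C_mul, pol, map_smul, map_smul, pol]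

theorem addSubst_isHomogeneous {n : ℕ} {f : MvPolynomial (Fin 2) K} (hf : f.IsHomogeneous n) :
    (addSubst f).IsHomogeneous n := by
  have := hf.aeval (n := 1) (fun j => X (Sum.inl j) + X (Sum.inr j) : Fin 2 → MvPolynomial Idx K)
    fun j => (isHomogeneous_X _ _).add (isHomogeneous_X _ _)
  rwa [one_mul] at this

theorem sum_pol {n : ℕ} {f : MvPolynomial (Fin 2) K} (hf : f.IsHomogeneous n) :
    ∑ p ∈ antidiagonal n, pol p.1 p.2 f = addSubst f :=
  sum_bicomp (addSubst_isHomogeneous hf)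

theorem pol_bihomogeneous (a b : ℕ) (f : MvPolynomial (Fin 2) K) :
    (pol a b f).IsWeightedHomogeneous bidegree (a, b) :=
  weightedHomogeneousComponent_isWeightedHomogeneous _ _

theorem pderiv_inl_addSubst (j : Fin 2) (f : MvPolynomial (Fin 2) K) :
    pderiv (Sum.inl j) (addSubst f) = addSubst (pderiv j f) := by
  rw [addSubst, derivation_aeval, Finset.sum_eq_single j]
  · simp
  · intro i _ hi
    simp [pderiv_X, hi.symm]
  · simp

theorem pderiv_inr_addSubst (j : Fin 2) (f : MvPolynomial (Fin 2) K) :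
    pderiv (Sum.inr j) (addSubst f) = addSubst (pderiv j f) := by
  rw [addSubst, derivation_aeval, Finset.sum_eq_single j]
  · simp
  · intro i _ hi
    simp [pderiv_X, hi.symm]
  · simp

theorem pderiv_inl_pol_succ (j : Fin 2) (a b : ℕ) (f : MvPolynomial (Fin 2) K) :
    pderiv (Sum.inl j) (pol (a + 1) b f) = pol a b (pderiv j f) := by
  rw [pol, pderiv_inl_bicomp_succ, pderiv_inl_addSubst, pol]

theorem pderiv_inl_pol_zero (j : Fin 2) (b : ℕ) (f : MvPolynomial (Fin 2) K) :
    pderiv (Sum.inl j) (pol 0 b f) = 0 :=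
  pderiv_inl_bicomp_zero j b _

theorem pderiv_inr_pol_succ (j : Fin 2) (a b : ℕ) (f : MvPolynomial (Fin 2) K) :
    pderiv (Sum.inr j) (pol a (b + 1) f) = pol a b (pderiv j f) := by
  rw [pol, pderiv_inr_bicomp_succ, pderiv_inr_addSubst, pol]

theorem pderiv_inr_pol_zero (j : Fin 2) (a : ℕ) (f : MvPolynomial (Fin 2) K) :
    pderiv (Sum.inr j) (pol a 0 f) = 0 :=
  pderiv_inr_bicomp_zero j a _

theorem map_pol {L : Type*} [CommRing L] (φ : K →+* L) (a b : ℕ) (f : MvPolynomial (Fin 2) K) :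
    map φ (pol a b f) = pol a b (map φ f) := by
  rw [pol, pol, map_bicomp]
  congr 1
  induction f using MvPolynomial.induction_on with
  | C r => simp [addSubst]
  | add p q hp hq => simp [hp, hq]
  | mul_X p i hp => simp only [map_mul, hp, map_X]; simp [addSubst]

theorem pol_linear_pow (c : Fin 2 → K) (a b : ℕ) :
    pol a b ((∑ j, C (c j) * X j) ^ (a + b)) =
      C ((a + b).choose a : K) *
        ((∑ j, C (c j) * X (Sum.inl j)) ^ a * (∑ j, C (c j) * X (Sum.inr j)) ^ b) := by
  set u : MvPolynomial Idx K := ∑ j, C (c j) * X (Sum.inl j) with hu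
  set v : MvPolynomial Idx K := ∑ j, C (c j) * X (Sum.inr j) with hv
  have hadd : addSubst ((∑ j, C (c j) * X j) ^ (a + b)) = (u + v) ^ (a + b) := by
    simp [addSubst, hu, hv, MvPolynomial.algebraMap_eq]
    ring
  have huw : u.IsWeightedHomogeneous bidegree (1, 0) := by
    refine IsWeightedHomogeneous.sum _ _ _ fun j _ => ?_
    exact (isWeightedHomogeneous_X K bidegree (Sum.inl j)).C_mul _
  have hvw : v.IsWeightedHomogeneous bidegree (0, 1) := by
    refine IsWeightedHomogeneous.sum _ _ _ fun j _ => ?_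
    exact (isWeightedHomogeneous_X K bidegree (Sum.inr j)).C_mul _
  rw [pol, hadd, (Commute.all u v).add_pow', map_sum, Finset.sum_eq_single (a, b)]
  · rw [map_nsmul, bicomp_mul_of_bihomogeneous (huw.pow a) (hvw.pow b), if_pos (by simp),
      nsmul_eq_mul, map_natCast]
  · intro p _ hp
    rw [map_nsmul, bicomp_mul_of_bihomogeneous (huw.pow p.1) (hvw.pow p.2), if_neg, smul_zero]
    intro h
    apply hp
    simpa using h
  · simp

/-- Restriction to the diagonal `x = y`. -/
def diag : MvPolynomial Idx K →ₐ[K] MvPolynomial (Fin 2) K :=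
  aeval (Sum.elim X X)

theorem pderiv_diag (j : Fin 2) (F : MvPolynomial Idx K) :
    pderiv j (diag F) = diag (pderiv (Sum.inl j) F) + diag (pderiv (Sum.inr j) F) := by
  rw [diag, derivation_aeval, Fintype.sum_sum_type]
  congr 1
  · rw [Finset.sum_eq_single j]
    · simp
    · intro i _ hi
      simp [pderiv_X, hi.symm]
    · simp
  · rw [Finset.sum_eq_single j]
    · simp
    · intro i _ hi
      simp [pderiv_X, hi.symm]
    · simp

theorem diag_isHomogeneous {n : ℕ} {F : MvPolynomial Idx K} (hF : F.IsHomogeneous n) :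
    (diag F).IsHomogeneous n := by
  have := hF.aeval (n := 1) (Sum.elim X X : Idx → MvPolynomial (Fin 2) K) (by
    rintro (j | j) <;> exact isHomogeneous_X _ _)
  rwa [one_mul] at this

theorem pol_isHomogeneous (a b : ℕ) (f : MvPolynomial (Fin 2) K) :
    (pol a b f).IsHomogeneous (a + b) := by
  intro d hd
  change Finsupp.weight (fun _ => 1) d = a + b
  rw [← Finsupp.degree_eq_weight_one]
  have h := pol_bihomogeneous a b f hd
  rw [weight_bidegree, Prod.ext_iff] at h
  simp only at h
  rw [degree_idx, h.1, h.2]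

end Polarization

/-! ### Polarizations restricted to the diagonal -/

section DiagonalValue

variable {K : Type*} [Field K] [CharZero K]

theorem pderiv_isHomogeneous {σ R : Type*} [CommSemiring R] {n : ℕ} {f : MvPolynomial σ R}
    (hf : f.IsHomogeneous (n + 1)) (j : σ) : (pderiv j f).IsHomogeneous n :=
  hf.pderiv

/-- Differentiating both sides lowers the degree, where Pascal's rule adds the two binomials;
Euler's identity recovers the form from its derivatives. -/
theorem diag_pol {a b : ℕ} {f : MvPolynomial (Fin 2) K} (hf : f.IsHomogeneous (a + b)) :
    diag (pol a b f) = C ((a + b).choose a : K) * f := by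
  obtain ⟨n, hn⟩ : ∃ n, a + b = n := ⟨_, rfl⟩
  induction n generalizing a b f with
  | zero =>
    obtain ⟨rfl, rfl⟩ : a = 0 ∧ b = 0 := by omega
    obtain ⟨r, rfl⟩ : ∃ r, f = C r :=
      ⟨_, totalDegree_eq_zero_iff_eq_C.mp ((totalDegree_zero_iff_isHomogeneous _).mpr hf)⟩
    have h0 := sum_pol hf
    simp only [add_zero, Finset.Nat.antidiagonal_zero, sum_singleton] at h0
    rw [h0]
    simp [diag, addSubst]
  | succ n ih =>
    have hne : ((n + 1 : ℕ) : MvPolynomial (Fin 2) K) ≠ 0 := by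
      exact_mod_cast Nat.succ_ne_zero n
    apply mul_left_cancel₀ hne
    have e1 := (diag_isHomogeneous (pol_isHomogeneous a b f)).sum_X_mul_pderiv
    have e2 := hf.sum_X_mul_pderiv
    rw [hn, nsmul_eq_mul] at e1 e2
    have key : ∀ j, pderiv j (diag (pol a b f)) = C ((a + b).choose a : K) * pderiv j f := by
      intro j
      have hfj : (pderiv j f).IsHomogeneous n := pderiv_isHomogeneous (hn ▸ hf) j
      rw [pderiv_diag]
      rcases a with _ | a <;> rcases b with _ | b
      · omega
      · rw [pderiv_inl_pol_zero, pderiv_inr_pol_succ, ih (by convert hfj using 1; omega) (by omega)]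
        simp
      · rw [pderiv_inr_pol_zero, pderiv_inl_pol_succ, ih (by convert hfj using 1; omega) (by omega)]
        simp
      · rw [pderiv_inr_pol_succ, pderiv_inl_pol_succ, ih (by convert hfj using 1; omega) (by omega),
          ih (by convert hfj using 1; omega) (by omega), ← add_mul, ← map_add]
        congr 2
        rw [show a + 1 + (b + 1) = (a + b + 1) + 1 by ring, Nat.choose_succ_succ,
          show a + (b + 1) = a + b + 1 by ring, show a + 1 + b = a + b + 1 by ring]
        push_cast
        ring
    rw [← e1, mul_left_comm, ← e2, Finset.mul_sum]
    refine Finset.sum_congr rfl fun j _ => ?_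
    rw [key]
    ring

end DiagonalValue

end PHO

end

/-! ### Sign of the coefficient sums and the Wronskian condition on the potential -/

noncomputable section

namespace PHO

open MvPolynomial Finset

/-! ### Two binomial sums -/

section BinomialSums

/-- The comparison is termwise: terms with negative denominator carry the middle binomial exactly,
and in the others replacing the binomial by the middle one only increases the term. What remains is
a telescoping sum. -/
theorem sum_choose_sq_div_le (n k : ℕ)
    (h1 : ∀ a ∈ range (n + 1), ((2 * a - n : ℝ)) ^ 2 < (k : ℝ) ^ 2 → n.choose a = n.choose (n / 2)) :
    ∑ a ∈ range (n + 1), (n.choose a : ℝ) ^ 2 / ((2 * a - n : ℝ) ^ 2 - (k : ℝ) ^ 2) ≤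
      (n.choose (n / 2) : ℝ) ^ 2 *
        ∑ a ∈ range (n + 1), 1 / ((2 * a - n : ℝ) ^ 2 - (k : ℝ) ^ 2) := by
  rw [Finset.mul_sum]
  refine Finset.sum_le_sum fun a ha => ?_
  rw [mul_one_div]
  by_cases h : ((2 * a - n : ℝ)) ^ 2 < (k : ℝ) ^ 2
  · rw [h1 a ha h]
  · have h2 : (n.choose a : ℝ) ≤ n.choose (n / 2) := by
      exact_mod_cast Nat.choose_le_middle a n
    have h3 : (0 : ℝ) ≤ (2 * a - n : ℝ) ^ 2 - (k : ℝ) ^ 2 := by linarith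
    gcongr

theorem sum_one_div_sub_one (n : ℕ) (hn : Even n) :
    ∑ a ∈ range (n + 1), 1 / ((2 * a - n : ℝ) ^ 2 - 1) = -1 / (n + 1 : ℝ) := by
  have hodd : ∀ a : ℕ, (2 * a - n - 1 : ℝ) ≠ 0 := by
    intro a h
    obtain ⟨m, rfl⟩ := hn
    have : (2 * a : ℤ) - (m + m : ℕ) - 1 = 0 := by exact_mod_cast h
    omega
  have key : ∀ a : ℕ, 1 / ((2 * a - n : ℝ) ^ 2 - 1) =
      -1 / 2 * (1 / (2 * ((a + 1 : ℕ) : ℝ) - n - 1) - 1 / (2 * a - n - 1)) := by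
    intro a
    have e1 := hodd a
    have e2 := hodd (a + 1)
    have e3 : ((2 * a - n : ℝ) ^ 2 - 1) = (2 * a - n - 1) * (2 * ((a + 1 : ℕ) : ℝ) - n - 1) := by
      push_cast
      ring
    rw [e3]
    field_simp
    push_cast
    ring
  simp_rw [key]
  rw [← Finset.mul_sum, Finset.sum_range_sub (fun a : ℕ => 1 / (2 * (a : ℝ) - n - 1))]
  have e : (n : ℝ) + 1 ≠ 0 := by positivity
  have e1 : (2 * ((n + 1 : ℕ) : ℝ) - n - 1) = n + 1 := by push_cast; ring
  have e2 : (2 * ((0 : ℕ) : ℝ) - n - 1) = -(n + 1) := by push_cast; ring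
  rw [e1, e2]
  field_simp
  norm_num

theorem sum_one_div_sub_four (n : ℕ) (hn : Odd n) :
    ∑ a ∈ range (n + 1), 1 / ((2 * a - n : ℝ) ^ 2 - 4) = -1 / 2 * (1 / (n + 2 : ℝ) + 1 / (n : ℝ)) := by
  have hodd : ∀ a : ℕ, (2 * a - n - 2 : ℝ) ≠ 0 := by
    intro a h
    obtain ⟨m, rfl⟩ := hn
    have : (2 * a : ℤ) - (2 * m + 1 : ℕ) - 2 = 0 := by exact_mod_cast h
    omega
  have hn0 : (n : ℝ) ≠ 0 := by
    have := hn.pos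
    positivity
  -- The partial fractions have linear factors two indices apart, so adding the intermediate term to
  -- both makes the sum telescope in steps of one.
  have key : ∀ a : ℕ, 1 / ((2 * a - n : ℝ) ^ 2 - 4) =
      -1 / 4 * ((1 / (2 * ((a + 1 : ℕ) : ℝ) - n - 2) + 1 / (2 * ((a + 1 + 1 : ℕ) : ℝ) - n - 2)) -
        (1 / (2 * (a : ℝ) - n - 2) + 1 / (2 * ((a + 1 : ℕ) : ℝ) - n - 2))) := by
    intro a
    have e1 := hodd a
    have e2 := hodd (a + 1 + 1)
    have e3 : ((2 * a - n : ℝ) ^ 2 - 4) =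
        (2 * a - n - 2) * (2 * ((a + 1 + 1 : ℕ) : ℝ) - n - 2) := by
      push_cast
      ring
    rw [e3, add_comm (1 / (2 * (a : ℝ) - n - 2)), add_sub_add_left_eq_sub]
    field_simp
    push_cast
    ring
  simp_rw [key]
  rw [← Finset.mul_sum, Finset.sum_range_sub
    (fun a : ℕ => 1 / (2 * (a : ℝ) - n - 2) + 1 / (2 * ((a + 1 : ℕ) : ℝ) - n - 2))]
  have e : (n : ℝ) + 2 ≠ 0 := by positivity
  have e1 : (2 * ((n + 1 : ℕ) : ℝ) - n - 2) = n := by push_cast; ring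
  have e2 : (2 * ((n + 1 + 1 : ℕ) : ℝ) - n - 2) = n + 2 := by push_cast; ring
  have e3 : (2 * ((0 : ℕ) : ℝ) - n - 2) = -(n + 2) := by push_cast; ring
  have e4 : (2 * ((0 + 1 : ℕ) : ℝ) - n - 2) = -n := by push_cast; ring
  rw [e1, e2, e3, e4]
  field_simp
  ring

theorem sum_antidiagonal_eq_sum_range_sub (n : ℕ) (f : ℕ → ℝ → ℝ) :
    ∑ p ∈ antidiagonal n, f p.1 ((p.1 : ℝ) - p.2) = ∑ a ∈ range (n + 1), f a (2 * a - n) := by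
  rw [Finset.Nat.sum_antidiagonal_eq_sum_range_succ (fun a b => f a ((a : ℝ) - b))]
  refine Finset.sum_congr rfl fun a ha => ?_
  rw [Nat.cast_sub (by simpa [Nat.lt_succ_iff] using ha)]
  congr 1
  ring

theorem sum_choose_sq_div_sub_one_neg (n : ℕ) (hn : Even n) :
    ∑ p ∈ antidiagonal n, (n.choose p.1 : ℝ) ^ 2 / (((p.1 : ℝ) - p.2) ^ 2 - 1) < 0 := by
  rw [sum_antidiagonal_eq_sum_range_sub n fun a d => (n.choose a : ℝ) ^ 2 / (d ^ 2 - 1)]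
  have h := sum_choose_sq_div_le n 1 (by
    intro a _ h
    have h' : (2 * (a : ℤ) - n) ^ 2 < 1 := by
      have : (2 * (a : ℝ) - n) ^ 2 < 1 := by simpa using h
      exact_mod_cast this
    have h'' : (2 * (a : ℤ) - n) = 0 := by
      by_contra hne
      have := sq_pos_of_ne_zero (a := 2 * (a : ℤ) - n) hne
      omega
    congr 1
    omega)
  simp only [Nat.cast_one, one_pow] at h
  refine h.trans_lt ?_
  rw [sum_one_div_sub_one n hn]
  have : (0 : ℝ) < n.choose (n / 2) := by
    exact_mod_cast Nat.choose_pos (Nat.div_le_self n 2)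
  apply mul_neg_of_pos_of_neg (by positivity)
  rw [neg_div]
  exact neg_lt_zero.mpr (by positivity)

theorem sum_choose_sq_div_sub_four_neg (n : ℕ) (hn : Odd n) :
    ∑ p ∈ antidiagonal n, (n.choose p.1 : ℝ) ^ 2 / (((p.1 : ℝ) - p.2) ^ 2 - 4) < 0 := by
  rw [sum_antidiagonal_eq_sum_range_sub n fun a d => (n.choose a : ℝ) ^ 2 / (d ^ 2 - 4)]
  have h := sum_choose_sq_div_le n 2 (by
    intro a _ h
    have h' : (2 * (a : ℤ) - n) ^ 2 < 2 ^ 2 := by exact_mod_cast h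
    have h2 := abs_lt_of_sq_lt_sq h' (by norm_num)
    rw [abs_lt] at h2
    obtain ⟨m, rfl⟩ := hn
    have e : (2 * m + 1) / 2 = m := by omega
    rw [e]
    obtain rfl | rfl : a = m ∨ a = m + 1 := by omega
    · rfl
    · exact Nat.choose_symm_of_eq_add (by omega))
  norm_num only [Nat.cast_ofNat] at h
  simp only [one_div] at h ⊢
  refine h.trans_lt ?_
  have e := sum_one_div_sub_four n hn
  simp only [one_div] at e
  rw [e]
  have : (0 : ℝ) < n.choose (n / 2) := by
    exact_mod_cast Nat.choose_pos (Nat.div_le_self n 2)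
  have hn0 := hn.pos
  apply mul_neg_of_pos_of_neg (by positivity)
  have : (0 : ℝ) < ((n : ℝ) + 2)⁻¹ + (n : ℝ)⁻¹ := by positivity
  linarith

end BinomialSums

theorem pderiv_pderiv_comm {σ R : Type*} [CommSemiring R] (i j : σ) (f : MvPolynomial σ R) :
    pderiv i (pderiv j f) = pderiv j (pderiv i f) := by
  classical
  ext d
  simp only [coeff_pderiv]
  rw [add_right_comm]
  rcases eq_or_ne i j with rfl | h
  · rfl
  · simp [h, h.symm]
    ring

/-! ### The polarized normal form and its image under the transvection -/

section Transvection

variable {K : Type*} [Field K]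

/-- The operator `∂²/∂x₀∂y₁ - ∂²/∂x₁∂y₀`. -/
def cayley (F : MvPolynomial Idx K) : MvPolynomial Idx K :=
  pderiv (Sum.inl 0) (pderiv (Sum.inr 1) F) - pderiv (Sum.inl 1) (pderiv (Sum.inr 0) F)

/-- Derivatives in x and in y of f(x + y) are the same derivatives of f, so the two mixed terms
cancel by symmetry of second derivatives. -/
theorem cayley_pol (a b : ℕ) (f : MvPolynomial (Fin 2) K) : cayley (pol a b f) = 0 := by
  rw [cayley]
  rcases b with _ | b
  · simp [pderiv_inr_pol_zero]
  · rcases a with _ | a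
    · simp [pderiv_inr_pol_succ, pderiv_inl_pol_zero]
    · simp only [pderiv_inr_pol_succ, pderiv_inl_pol_succ]
      rw [pderiv_pderiv_comm, sub_self]

theorem cayley_mul {G H : MvPolynomial Idx K} (hG : cayley G = 0) (hH : cayley H = 0) :
    cayley (G * H) =
      pderiv (Sum.inl 0) G * pderiv (Sum.inr 1) H + pderiv (Sum.inr 1) G * pderiv (Sum.inl 0) H
        - pderiv (Sum.inl 1) G * pderiv (Sum.inr 0) H
        - pderiv (Sum.inr 0) G * pderiv (Sum.inl 1) H := by
  rw [cayley] at *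
  simp only [Derivation.leibniz, smul_eq_mul, map_add]
  linear_combination H * hG + G * hH

theorem sum_mul_pderiv_inl_mul_pderiv_inr (M : ℕ) (c : ℕ → ℕ → K) (i k : Fin 2)
    (f g : MvPolynomial (Fin 2) K) :
    ∑ p ∈ antidiagonal (M + 1), C (c p.1 p.2) *
      (pderiv (Sum.inl i) (pol p.1 p.2 f) * pderiv (Sum.inr k) (pol p.2 p.1 g)) =
    ∑ p ∈ antidiagonal M, C (c (p.1 + 1) p.2) *
      (pol p.1 p.2 (pderiv i f) * pol p.2 p.1 (pderiv k g)) := by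
  rw [Finset.Nat.sum_antidiagonal_succ]
  simp [pderiv_inl_pol_zero, pderiv_inl_pol_succ, pderiv_inr_pol_succ]

theorem sum_mul_pderiv_inr_mul_pderiv_inl (M : ℕ) (c : ℕ → ℕ → K) (i k : Fin 2)
    (f g : MvPolynomial (Fin 2) K) :
    ∑ p ∈ antidiagonal (M + 1), C (c p.1 p.2) *
      (pderiv (Sum.inr i) (pol p.1 p.2 f) * pderiv (Sum.inl k) (pol p.2 p.1 g)) =
    ∑ p ∈ antidiagonal M, C (c p.1 (p.2 + 1)) *
      (pol p.1 p.2 (pderiv i f) * pol p.2 p.1 (pderiv k g)) := by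
  rw [Finset.Nat.sum_antidiagonal_succ']
  simp [pderiv_inr_pol_zero, pderiv_inl_pol_succ, pderiv_inr_pol_succ]

/-- Each factor is itself killed by `cayley`, so only products of first derivatives survive.
Collecting them by bidegree shifts the coefficient by one index in x or in y, whence the difference
of neighbouring coefficients. -/
theorem cayley_sum_pol_mul_pol (M : ℕ) (c : ℕ → ℕ → K) (f : MvPolynomial (Fin 2) K) :
    cayley (∑ p ∈ antidiagonal (M + 1), C (c p.1 p.2) * (pol p.1 p.2 f * pol p.2 p.1 f)) =
    ∑ p ∈ antidiagonal M, C (c (p.1 + 1) p.2 - c p.1 (p.2 + 1)) *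
      (pol p.1 p.2 (pderiv 0 f) * pol p.2 p.1 (pderiv 1 f) -
        pol p.1 p.2 (pderiv 1 f) * pol p.2 p.1 (pderiv 0 f)) := by
  have h : ∀ (s : Finset (ℕ × ℕ)), cayley (∑ p ∈ s, C (c p.1 p.2) *
      (pol p.1 p.2 f * pol p.2 p.1 f)) =
      ∑ p ∈ s, C (c p.1 p.2) * cayley (pol p.1 p.2 f * pol p.2 p.1 f) := by
    intro s
    simp only [cayley, map_sum, pderiv_C_mul, ← Finset.sum_sub_distrib, ← mul_sub]
  rw [h]
  simp only [cayley_mul (cayley_pol _ _ _) (cayley_pol _ _ _), mul_add, mul_sub,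
    Finset.sum_add_distrib, Finset.sum_sub_distrib, sum_mul_pderiv_inl_mul_pderiv_inr,
    sum_mul_pderiv_inr_mul_pderiv_inl, map_sub, sub_mul]
  ring

theorem diag_C_mul (c : K) (F : MvPolynomial Idx K) : diag (C c * F) = C c * diag F := by
  simp [diag]

variable [CharZero K]

theorem diag_pderiv_inl_pol {a b : ℕ} {f : MvPolynomial (Fin 2) K} (hf : f.IsHomogeneous (a + b))
    (i : Fin 2) :
    C ((a + b : ℕ) : K) * diag (pderiv (Sum.inl i) (pol a b f)) =
      C (a * (a + b).choose a : K) * pderiv i f := by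
  rcases a with _ | a
  · simp [pderiv_inl_pol_zero]
  · have h : (pderiv i f).IsHomogeneous (a + b) :=
      pderiv_isHomogeneous (by convert hf using 1; ring) i
    rw [pderiv_inl_pol_succ, diag_pol h, ← mul_assoc, ← map_mul]
    congr 2
    rw [show a + 1 + b = a + b + 1 by ring]
    have := Nat.add_one_mul_choose_eq (a + b) a
    rw [mul_comm ((a + 1 : ℕ) : K)]
    exact_mod_cast this

/-- On x = y the antisymmetric product itself vanishes; its first derivative is the leading
information there. The x-derivative weighs the two factors by a and b, and antisymmetrization leaves
a - b. -/
theorem diag_pderiv_inl_wedge {a b : ℕ} {f g : MvPolynomial (Fin 2) K}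
    (hf : f.IsHomogeneous (a + b)) (hg : g.IsHomogeneous (a + b)) (i : Fin 2) :
    C ((a + b : ℕ) : K) * diag (pderiv (Sum.inl i) (pol a b f * pol b a g - pol a b g * pol b a f)) =
      C (((a : K) - b) * ((a + b).choose a : K) ^ 2) * (pderiv i f * g - f * pderiv i g) := by
  have hf' : f.IsHomogeneous (b + a) := by rwa [add_comm]
  have hg' : g.IsHomogeneous (b + a) := by rwa [add_comm]
  have hc : (b + a).choose b = (a + b).choose a := by
    rw [add_comm b a]; exact (Nat.choose_symm_add).symm
  have e1 := diag_pderiv_inl_pol hf i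
  have e2 := diag_pderiv_inl_pol hg i
  have e3 := diag_pderiv_inl_pol hf' i
  have e4 := diag_pderiv_inl_pol hg' i
  rw [hc, add_comm b a] at e3 e4
  simp only [map_sub, Derivation.leibniz, smul_eq_mul, map_add, map_mul, diag_pol hf, diag_pol hg,
    diag_pol hf', diag_pol hg', hc, map_pow] at *
  linear_combination C ((a + b).choose a : K) * g * e1 + C ((a + b).choose a : K) * f * e4
    - C ((a + b).choose a : K) * f * e2 - C ((a + b).choose a : K) * g * e3

end Transvection

/-- The relation `Π U = Π (½ (|∂W/∂q|² - |∂W/∂η|²))`, `D W = V`, between the potentials `V` of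
degree `N + 1` and `U` of degree `2 N`, where `Π` is the projection onto the kernel of `D`, written
in the coordinates in which `D` is diagonal. -/
def PolarizedMatch (N : ℕ) (V U : MvPolynomial (Fin 2) ℝ) : Prop :=
  pol N N U = C (1 / 2) * ∑ j : Fin 2, ∑ p ∈ antidiagonal N,
    C (1 / (((p.1 : ℝ) - p.2) ^ 2 - 1)) *
      (pol p.1 p.2 (pderiv j V) * pol p.2 p.1 (pderiv j V))

/-- The identity prescribes `pol N N U`, whose restriction to the diagonal is a nonzero multiple of
U. -/
theorem PolarizedMatch.unique {N : ℕ} {V U U' : MvPolynomial (Fin 2) ℝ}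
    (hU : U.IsHomogeneous (N + N)) (hU' : U'.IsHomogeneous (N + N))
    (h : PolarizedMatch N V U) (h' : PolarizedMatch N V U') : U = U' := by
  have e : diag (pol N N U) = diag (pol N N U') := by rw [h, h']
  rw [diag_pol hU, diag_pol hU'] at e
  refine mul_left_cancel₀ ?_ e
  rw [Ne, C_eq_zero]
  exact_mod_cast (Nat.choose_pos (Nat.le_add_right N N)).ne'

/-- Summing over j the Wronskians of ∂₀∂ⱼV and ∂₁∂ⱼV gives the single Wronskian of V₀₀ - V₁₁ and
V₀₁, since V₀₁ occurs in both. Its scalar factor is -4 times the sum of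
`sum_choose_sq_div_sub_four_neg`. -/
theorem PolarizedMatch.wronskian {M : ℕ} (hM : Odd M) {V U : MvPolynomial (Fin 2) ℝ}
    (hV : V.IsHomogeneous (M + 2)) (h : PolarizedMatch (M + 1) V U) (i : Fin 2) :
    pderiv i (pderiv 0 (pderiv 0 V) - pderiv 1 (pderiv 1 V)) * pderiv 0 (pderiv 1 V) =
      (pderiv 0 (pderiv 0 V) - pderiv 1 (pderiv 1 V)) * pderiv i (pderiv 0 (pderiv 1 V)) := by
  have h0 := cayley_pol (M + 1) (M + 1) U
  rw [h] at h0
  have hlin : ∀ (c : ℝ) (F G : MvPolynomial Idx ℝ),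
      cayley (C c * (F + G)) = C c * (cayley F + cayley G) := by
    intro c F G
    simp only [cayley, map_add, pderiv_C_mul]
    ring
  rw [Fin.sum_univ_two, hlin, cayley_sum_pol_mul_pol M (fun a b => 1 / (((a : ℝ) - b) ^ 2 - 1)),
    cayley_sum_pol_mul_pol M (fun a b => 1 / (((a : ℝ) - b) ^ 2 - 1))] at h0
  have h1 : ∑ j : Fin 2, ∑ p ∈ antidiagonal M,
      C (1 / ((((p.1 + 1 : ℕ) : ℝ) - p.2) ^ 2 - 1) - 1 / (((p.1 : ℝ) - (p.2 + 1 : ℕ)) ^ 2 - 1)) *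
      (pol p.1 p.2 (pderiv 0 (pderiv j V)) * pol p.2 p.1 (pderiv 1 (pderiv j V)) -
        pol p.1 p.2 (pderiv 1 (pderiv j V)) * pol p.2 p.1 (pderiv 0 (pderiv j V))) = 0 := by
    rw [Fin.sum_univ_two]
    refine (mul_eq_zero.mp h0).resolve_left ?_
    rw [C_eq_zero]
    norm_num
  -- Restriction to the diagonal alone would give 0 = 0; one derivative must be taken first.
  have h2 := congrArg (fun F => C (M : ℝ) * diag (pderiv (Sum.inl i) F)) h1
  simp only [map_sum, map_zero, mul_zero, Finset.mul_sum, pderiv_C_mul, diag_C_mul] at h2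
  have hhom : ∀ j k, (pderiv k (pderiv j V)).IsHomogeneous M := fun j k =>
    pderiv_isHomogeneous (pderiv_isHomogeneous hV j) k
  have h3 : ∀ j, ∀ p ∈ antidiagonal M,
      C (M : ℝ) * (C (1 / ((((p.1 + 1 : ℕ) : ℝ) - p.2) ^ 2 - 1) -
        1 / (((p.1 : ℝ) - (p.2 + 1 : ℕ)) ^ 2 - 1)) * diag (pderiv (Sum.inl i)
      (pol p.1 p.2 (pderiv 0 (pderiv j V)) * pol p.2 p.1 (pderiv 1 (pderiv j V)) -
        pol p.1 p.2 (pderiv 1 (pderiv j V)) * pol p.2 p.1 (pderiv 0 (pderiv j V))))) =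
      C (-4 * ((M.choose p.1 : ℝ) ^ 2 / (((p.1 : ℝ) - p.2) ^ 2 - 4))) *
        (pderiv i (pderiv 0 (pderiv j V)) * pderiv 1 (pderiv j V) -
          pderiv 0 (pderiv j V) * pderiv i (pderiv 1 (pderiv j V))) := by
    rintro j ⟨a, b⟩ hp
    rw [HasAntidiagonal.mem_antidiagonal] at hp
    simp only at hp ⊢
    subst hp
    rw [mul_left_comm, diag_pderiv_inl_wedge (hhom _ _) (hhom _ _), ← mul_assoc, ← map_mul]
    congr 2
    -- With d = a - b odd, none of d, d + 2, d - 2 vanishes. The difference of coefficients is -4 /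
    -- (d (d² - 4)), and the factor d cancels against a - b from `diag_pderiv_inl_wedge`.
    have hne : ∀ m : ℤ, Even m → ((a : ℝ) - b + m) ≠ 0 := by
      intro m hm hz
      have : (a : ℤ) - b + m = 0 := by exact_mod_cast hz
      rw [Nat.odd_iff] at hM
      rw [Int.even_iff] at hm
      omega
    have d0 := hne 0 (by decide)
    have d2 := hne 2 (by decide)
    have d2' := hne (-2) (by decide)
    push_cast at d0 d2 d2'
    rw [add_zero] at d0
    have f1 : ((((a + 1 : ℕ) : ℝ) - b) ^ 2 - 1) = ((a : ℝ) - b) * ((a : ℝ) - b + 2) := by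
      push_cast; ring
    have f2 : (((a : ℝ) - (b + 1 : ℕ)) ^ 2 - 1) = ((a : ℝ) - b) * ((a : ℝ) - b + -2) := by
      push_cast; ring
    have f3 : (((a : ℝ) - b) ^ 2 - 4) = ((a : ℝ) - b + 2) * ((a : ℝ) - b + -2) := by ring
    rw [f1, f2, f3]
    field_simp
    ring
  have h4 := h2
  rw [Finset.sum_congr rfl fun j _ => Finset.sum_congr rfl fun p hp => h3 j p hp] at h4
  simp only [← Finset.sum_mul, ← map_sum, ← Finset.mul_sum] at h4
  have h5 := (mul_eq_zero.mp h4).resolve_left (by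
    rw [C_eq_zero]
    exact (mul_pos_of_neg_of_neg (by norm_num) (sum_choose_sq_div_sub_four_neg M hM)).ne')
  rw [Fin.sum_univ_two, pderiv_pderiv_comm 1 0] at h5
  rw [map_sub]
  linear_combination h5

end PHO

end

/-! ### Linear dependence of forms, rotations and split potentials -/

noncomputable section

namespace PHO

open MvPolynomial Finset

/-! ### Forms with vanishing Wronskian -/

/-- A common factor g only multiplies the Wronskian by g². After division by the gcd the two
polynomials are coprime, and a vanishing Wronskian then forces both derivatives to vanish, so both
are constants. -/
theorem exists_linear_relation_of_wronskian_eq_zero (α β : Polynomial ℝ)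
    (h : Polynomial.wronskian α β = 0) :
    ∃ c d : ℝ, (c ≠ 0 ∨ d ≠ 0) ∧ Polynomial.C c * α + Polynomial.C d * β = 0 := by
  by_cases h0 : α = 0
  · exact ⟨1, 0, Or.inl one_ne_zero, by simp [h0]⟩
  obtain ⟨g, a, b, hab, rfl, rfl⟩ :
      ∃ g a b : Polynomial ℝ, IsCoprime a b ∧ α = g * a ∧ β = g * b := by
    obtain ⟨a, b, ha, hb, hu⟩ := extract_gcd α β
    exact ⟨_, a, b, (gcd_isUnit_iff a b).mp hu, ha, hb⟩
  have hw : Polynomial.wronskian (g * a) (g * b) = g ^ 2 * Polynomial.wronskian a b := by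
    simp only [Polynomial.wronskian, Polynomial.derivative_mul]
    ring
  have hg : g ≠ 0 := left_ne_zero_of_mul h0
  rw [hw, mul_eq_zero, or_iff_right (pow_ne_zero 2 hg), hab.wronskian_eq_zero_iff] at h
  obtain ⟨c, rfl⟩ : ∃ c, a = Polynomial.C c := ⟨_, Polynomial.eq_C_of_derivative_eq_zero h.1⟩
  obtain ⟨d, rfl⟩ : ∃ d, b = Polynomial.C d := ⟨_, Polynomial.eq_C_of_derivative_eq_zero h.2⟩
  refine ⟨d, -c, ?_, ?_⟩
  · by_contra! hcd
    obtain ⟨rfl, hc⟩ := hcd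
    rw [neg_eq_zero] at hc
    subst hc
    simp at h0
  · rw [map_neg]
    ring

theorem eval_smul_of_isHomogeneous {σ : Type*} {n : ℕ} {F : MvPolynomial σ ℝ}
    (hF : F.IsHomogeneous n) (t : ℝ) (v : σ → ℝ) :
    eval (fun i => t * v i) F = t ^ n * eval v F := by
  rw [eval_eq, eval_eq, Finset.mul_sum]
  refine Finset.sum_congr rfl fun d hd => ?_
  simp only [mul_pow, Finset.prod_mul_distrib, Finset.prod_pow_eq_pow_sum]
  have : ∑ i ∈ d.support, d i = n := by
    have h := hF (mem_support_iff.mp hd)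
    change Finsupp.weight (fun _ => 1) d = n at h
    rw [← Finsupp.degree_eq_weight_one] at h
    exact h
  rw [this]
  ring

theorem eq_zero_of_dehomogenize_eq_zero {n : ℕ} {F : MvPolynomial (Fin 2) ℝ}
    (hF : F.IsHomogeneous n) (h : aeval ![(Polynomial.X : Polynomial ℝ), 1] F = 0) : F = 0 := by
  -- Homogeneity determines F only where v₁ ≠ 0; the factor X 1 takes care of the line v₁ = 0.
  have h1 : F * X 1 = 0 := by
    apply MvPolynomial.funext
    intro v
    rw [map_mul, eval_X, map_zero]
    by_cases hv : v 1 = 0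
    · rw [hv, mul_zero]
    · have e : v = fun i => v 1 * ![v 0 / v 1, 1] i := by
        ext i
        fin_cases i
        · simp [mul_div_cancel₀ _ hv]
        · simp
      have e2 : eval ![v 0 / v 1, 1] F = 0 := by
        have := congrArg (Polynomial.eval (v 0 / v 1)) h
        rw [Polynomial.eval_zero, ← Polynomial.coe_aeval_eq_eval] at this
        change ((Polynomial.aeval (v 0 / v 1)).comp (aeval _)) F = 0 at this
        rw [comp_aeval] at this
        rw [← this, ← coe_aeval_eq_eval]
        change aeval _ F = _
        congr 2
        ext i
        fin_cases i <;> simp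
      rw [e, eval_smul_of_isHomogeneous hF, e2]
      simp
  exact (mul_eq_zero.mp h1).resolve_right (X_ne_zero 1)

/-- Setting the second variable to 1 commutes with the derivative in the first and reduces the claim
to polynomials in one variable, without loss because both forms have the same degree. -/
theorem exists_linear_relation_of_wronskian {n : ℕ} {A B : MvPolynomial (Fin 2) ℝ}
    (hA : A.IsHomogeneous n) (hB : B.IsHomogeneous n)
    (h : pderiv 0 A * B = A * pderiv 0 B) :
    ∃ c d : ℝ, (c ≠ 0 ∨ d ≠ 0) ∧ C c * A + C d * B = 0 := by
  set θ := aeval (R := ℝ) ![(Polynomial.X : Polynomial ℝ), 1] with hθ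
  have hder : ∀ F : MvPolynomial (Fin 2) ℝ, Polynomial.derivative (θ F) = θ (pderiv 0 F) := by
    intro F
    have := derivation_aeval Polynomial.derivative' ![(Polynomial.X : Polynomial ℝ), 1] F
    simpa [Polynomial.derivative'] using this
  obtain ⟨c, d, hcd, e⟩ := exists_linear_relation_of_wronskian_eq_zero (θ A) (θ B) (by
    rw [Polynomial.wronskian, hder, hder, ← map_mul, ← map_mul, h, sub_self])
  refine ⟨c, d, hcd, eq_zero_of_dehomogenize_eq_zero ((hA.C_mul c).add (hB.C_mul d)) ?_⟩
  rw [← hθ, map_add, map_mul, map_mul, ← e]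
  simp [hθ]

/-! ### Rotated potentials -/

theorem rot_inv (ψ : ℝ) :
    (rot ψ)⁻¹ = !![Real.cos ψ, Real.sin ψ; -Real.sin ψ, Real.cos ψ] := by
  apply Matrix.inv_eq_right_inv
  have h := Real.sin_sq_add_cos_sq ψ
  ext i j
  fin_cases i <;> fin_cases j <;> simp [rot, Matrix.mul_apply, Fin.sum_univ_two] <;>
    linarith

/-- The potential in the rotated coordinates. -/
def rotPoly (ψ : ℝ) : MvPolynomial (Fin 2) ℝ →ₐ[ℝ] MvPolynomial (Fin 2) ℝ :=
  aeval ![C (Real.cos ψ) * X 0 + C (Real.sin ψ) * X 1,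
    C (-Real.sin ψ) * X 0 + C (Real.cos ψ) * X 1]

theorem eval_rotPoly (ψ : ℝ) (V : MvPolynomial (Fin 2) ℝ) (q : Fin 2 → ℝ) :
    eval q (rotPoly ψ V) = eval ((rot ψ)⁻¹ *ᵥ q) V := by
  rw [rotPoly, rot_inv, ← coe_aeval_eq_eval, ← coe_aeval_eq_eval]
  change ((aeval q).comp (aeval _)) V = _
  rw [comp_aeval]
  change _ = aeval _ V
  congr 2
  ext i
  fin_cases i <;> simp [Matrix.mulVec, dotProduct, Fin.sum_univ_two]

theorem rotPoly_isHomogeneous (ψ : ℝ) {n : ℕ} {V : MvPolynomial (Fin 2) ℝ}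
    (hV : V.IsHomogeneous n) : (rotPoly ψ V).IsHomogeneous n := by
  have := hV.aeval (τ := Fin 2) (n := 1) ![C (Real.cos ψ) * X 0 + C (Real.sin ψ) * X 1,
    C (-Real.sin ψ) * X 0 + C (Real.cos ψ) * X 1] (by
      intro i
      fin_cases i <;> exact (isHomogeneous_C_mul_X _ _).add (isHomogeneous_C_mul_X _ _))
  rw [one_mul] at this
  exact this

theorem rotPoly_rotPoly_neg (ψ : ℝ) (V : MvPolynomial (Fin 2) ℝ) :
    rotPoly ψ (rotPoly (-ψ) V) = V := by
  have h := Real.sin_sq_add_cos_sq ψ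
  apply MvPolynomial.funext
  intro q
  rw [eval_rotPoly, eval_rotPoly, Matrix.mulVec_mulVec, rot_inv, rot_inv]
  have : (!![Real.cos (-ψ), Real.sin (-ψ); -Real.sin (-ψ), Real.cos (-ψ)] *
      !![Real.cos ψ, Real.sin ψ; -Real.sin ψ, Real.cos ψ]) = 1 := by
    ext i j
    fin_cases i <;> fin_cases j <;> simp [Matrix.mul_apply, Fin.sum_univ_two] <;> linarith
  rw [this, Matrix.one_mulVec]

/-- The mixed second derivative of the potential vanishes in the coordinates rotated by `ψ`. -/
def IsSplit (ψ : ℝ) (V : MvPolynomial (Fin 2) ℝ) : Prop :=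
  pderiv 0 (pderiv 1 (rotPoly ψ V)) = 0

theorem pderiv_rotPoly_zero (ψ : ℝ) (V : MvPolynomial (Fin 2) ℝ) :
    pderiv 0 (rotPoly ψ V) =
      C (Real.cos ψ) * rotPoly ψ (pderiv 0 V) - C (Real.sin ψ) * rotPoly ψ (pderiv 1 V) := by
  rw [rotPoly, derivation_aeval, Fin.sum_univ_two]
  simp [pderiv_X]
  ring

theorem pderiv_rotPoly_one (ψ : ℝ) (V : MvPolynomial (Fin 2) ℝ) :
    pderiv 1 (rotPoly ψ V) =
      C (Real.sin ψ) * rotPoly ψ (pderiv 0 V) + C (Real.cos ψ) * rotPoly ψ (pderiv 1 V) := by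
  rw [rotPoly, derivation_aeval, Fin.sum_univ_two]
  simp [pderiv_X]
  ring

theorem exists_isSplit_of_linear_relation {V : MvPolynomial (Fin 2) ℝ} {c d : ℝ}
    (hcd : c ≠ 0 ∨ d ≠ 0)
    (h : C c * (pderiv 0 (pderiv 0 V) - pderiv 1 (pderiv 1 V)) + C d * pderiv 0 (pderiv 1 V) = 0) :
    ∃ ψ, IsSplit ψ V := by
  -- In the rotated coordinates the mixed derivative is sin ψ cos ψ (V₀₀ - V₁₁) + cos 2ψ V₀₁. It is
  -- a multiple of the given relation when (sin 2ψ, cos 2ψ) is proportional to (2c, d), that is,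
  -- when 2ψ is the argument of d + 2ci.
  set z : ℂ := ⟨d, 2 * c⟩ with hz
  have hz0 : z ≠ 0 := by
    intro h0
    have h1 := congrArg Complex.re h0
    have h2 := congrArg Complex.im h0
    simp only [hz, Complex.zero_re, Complex.zero_im] at h1 h2
    rcases hcd with hc | hd
    · exact hc (by linarith)
    · exact hd h1
  have hn : (‖z‖ : ℝ) ≠ 0 := norm_ne_zero_iff.mpr hz0
  have hcos : Real.cos z.arg = d / ‖z‖ := Complex.cos_arg hz0
  have hsin : Real.sin z.arg = 2 * c / ‖z‖ := Complex.sin_arg z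
  refine ⟨z.arg / 2, ?_⟩
  have e1 : Real.cos z.arg = Real.cos (z.arg / 2) ^ 2 - Real.sin (z.arg / 2) ^ 2 := by
    rw [← Real.cos_two_mul', mul_div_cancel₀ _ two_ne_zero]
  have e2 : Real.sin z.arg = 2 * Real.sin (z.arg / 2) * Real.cos (z.arg / 2) := by
    rw [← Real.sin_two_mul, mul_div_cancel₀ _ two_ne_zero]
  set ψ := z.arg / 2
  have f1 : Real.cos ψ ^ 2 - Real.sin ψ ^ 2 = ‖z‖⁻¹ * d := by
    rw [← e1, hcos]; ring
  have f2 : Real.sin ψ * Real.cos ψ = ‖z‖⁻¹ * c := by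
    have : 2 * Real.sin ψ * Real.cos ψ = 2 * (‖z‖⁻¹ * c) := by rw [← e2, hsin]; ring
    linarith
  have g1 := congrArg (fun t => rotPoly ψ (C (‖z‖⁻¹) * t)) h
  have hC : ∀ r : ℝ, rotPoly ψ (C r) = C r := fun r => by simp [rotPoly]
  simp only [map_mul, map_add, map_sub, hC, mul_zero, map_zero] at g1
  rw [IsSplit, pderiv_rotPoly_one, map_add, pderiv_C_mul, pderiv_C_mul, pderiv_rotPoly_zero,
    pderiv_rotPoly_zero, pderiv_pderiv_comm 1 0]
  have f1' := congrArg (C : ℝ → MvPolynomial (Fin 2) ℝ) f1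
  have f2' := congrArg (C : ℝ → MvPolynomial (Fin 2) ℝ) f2
  simp only [map_sub, map_mul, map_pow] at f1' f2'
  linear_combination g1 + rotPoly ψ (pderiv 0 (pderiv 1 V)) * f1' +
    (rotPoly ψ (pderiv 0 (pderiv 0 V)) - rotPoly ψ (pderiv 1 (pderiv 1 V))) * f2'

theorem PolarizedMatch.exists_isSplit {M : ℕ} (hM : Odd M) {V U : MvPolynomial (Fin 2) ℝ}
    (hV : V.IsHomogeneous (M + 2)) (h : PolarizedMatch (M + 1) V U) : ∃ ψ, IsSplit ψ V := by
  have hhom : ∀ j k, (pderiv k (pderiv j V)).IsHomogeneous M := fun j k =>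
    pderiv_isHomogeneous (pderiv_isHomogeneous hV j) k
  obtain ⟨c, d, hcd, e⟩ := exists_linear_relation_of_wronskian
    ((hhom 0 0).sub (hhom 1 1)) (hhom 1 0) (h.wronskian hM hV 0)
  exact exists_isSplit_of_linear_relation hcd e

theorem eq_sum_pow_of_pderiv_pderiv_eq_zero {n : ℕ} {F : MvPolynomial (Fin 2) ℝ}
    (hF : F.IsHomogeneous (n + 1)) (h : pderiv 0 (pderiv 1 F) = 0) :
    ∃ a b : ℝ, F = C a * X 0 ^ (n + 1) + C b * X 1 ^ (n + 1) := by
  refine ⟨coeff (Finsupp.single 0 (n + 1)) F, coeff (Finsupp.single 1 (n + 1)) F, ?_⟩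
  ext d
  rw [coeff_add, coeff_C_mul, coeff_C_mul, coeff_X_pow, coeff_X_pow]
  by_cases hd : d.degree = n + 1
  · rw [Finsupp.degree_eq_sum, Fin.sum_univ_two] at hd
    by_cases h0 : d 0 = 0
    · have : d = Finsupp.single 1 (n + 1) := by
        ext i
        fin_cases i
        · simpa using h0
        · simp; omega
      subst this
      rw [if_neg (by rw [Finsupp.single_eq_single_iff]; simp), if_pos rfl]
      ring
    by_cases h1 : d 1 = 0
    · have : d = Finsupp.single 0 (n + 1) := by
        ext i
        fin_cases i
        · simp; omega
        · simpa using h1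
      subst this
      rw [if_pos rfl, if_neg (by rw [Finsupp.single_eq_single_iff]; simp)]
      ring
    · rw [if_neg, if_neg]
      · obtain ⟨e, rfl⟩ : ∃ e, d = e + Finsupp.single 0 1 + Finsupp.single 1 1 := by
          refine ⟨d - Finsupp.single 0 1 - Finsupp.single 1 1, ?_⟩
          ext i
          fin_cases i
          · simp; omega
          · simp; omega
        have := congrArg (coeff e) h
        simp only [coeff_pderiv, coeff_zero, mul_eq_zero] at this
        rcases this with (h' | h') | h'
        · simp [h']
        · norm_cast at h'
        · norm_cast at h'
      · intro hd'
        rw [← hd'] at h0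
        simp at h0
      · intro hd'
        rw [← hd'] at h1
        simp at h1
  · rw [hF.coeff_eq_zero hd, if_neg, if_neg]
    · ring
    · rintro rfl
      simp at hd
    · rintro rfl
      simp at hd

/-- The linear form that becomes the `i`-th coordinate after rotation by `ψ`. -/
def rotForm (ψ : ℝ) (i : Fin 2) : MvPolynomial (Fin 2) ℝ := ∑ j, C (rot ψ i j) * X j

theorem rotPoly_rotForm (ψ : ℝ) (i : Fin 2) : rotPoly ψ (rotForm ψ i) = X i := by
  have h : C (Real.sin ψ) ^ 2 + C (Real.cos ψ) ^ 2 = (1 : MvPolynomial (Fin 2) ℝ) := by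
    rw [← map_pow, ← map_pow, ← map_add, Real.sin_sq_add_cos_sq, map_one]
  fin_cases i
  · simp [rotForm, rotPoly, rot, Fin.sum_univ_two]
    linear_combination X 0 * h
  · simp [rotForm, rotPoly, rot, Fin.sum_univ_two]
    linear_combination X 1 * h

theorem rotPoly_injective (ψ : ℝ) : Function.Injective (rotPoly ψ) := by
  have h : Function.LeftInverse (rotPoly (-ψ)) (rotPoly ψ) := fun V => by
    simpa using rotPoly_rotPoly_neg (-ψ) V
  exact h.injective

/-- In the rotated coordinates no mixed monomial survives, so only the two pure powers remain;
rotating back turns the coordinates into the forms `rotForm ψ i`. -/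
theorem IsSplit.eq_sum_pow {n : ℕ} {ψ : ℝ} {V : MvPolynomial (Fin 2) ℝ}
    (hV : V.IsHomogeneous (n + 1)) (h : IsSplit ψ V) :
    ∃ c : Fin 2 → ℝ, V = ∑ i, C (c i) * rotForm ψ i ^ (n + 1) := by
  obtain ⟨a, b, e⟩ := eq_sum_pow_of_pderiv_pderiv_eq_zero (rotPoly_isHomogeneous ψ hV) h
  refine ⟨![a, b], rotPoly_injective ψ ?_⟩
  have hC : ∀ r : ℝ, rotPoly ψ (C r) = C r := fun r => by simp [rotPoly]
  simp only [e, Fin.sum_univ_two, map_add, map_mul, map_pow, rotPoly_rotForm, hC]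
  simp

theorem rot_orthonormal (ψ : ℝ) (i k : Fin 2) :
    ∑ j, rot ψ i j * rot ψ k j = if i = k then 1 else 0 := by
  have h := Real.sin_sq_add_cos_sq ψ
  fin_cases i <;> fin_cases k <;> simp [rot, Fin.sum_univ_two] <;> linarith

theorem rotForm_isHomogeneous (ψ : ℝ) (i : Fin 2) : (rotForm ψ i).IsHomogeneous 1 :=
  IsHomogeneous.sum _ _ _ fun _ _ => isHomogeneous_C_mul_X _ _

theorem pderiv_rotForm_pow (ψ : ℝ) (i j : Fin 2) (n : ℕ) :
    pderiv j (rotForm ψ i ^ (n + 1)) = C ((n + 1 : ℝ) * rot ψ i j) * rotForm ψ i ^ n := by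
  have : pderiv j (rotForm ψ i) = C (rot ψ i j) := by
    fin_cases j <;> simp [rotForm, Fin.sum_univ_two, pderiv_X]
  rw [pderiv_pow, this]
  simp
  ring

/-- Summation over j applies r rᵀ = 1, which removes the cross terms between the two linear forms.
-/
theorem sum_mul_of_orthonormal {R : Type*} [CommRing R] {r : Fin 2 → Fin 2 → R}
    (hr : ∀ i k, ∑ j, r i j * r k j = if i = k then 1 else 0) (k : R) (c Z W : Fin 2 → R) :
    ∑ j, (k * ∑ i, c i * r i j * Z i) * (k * ∑ i, c i * r i j * W i) =
      k ^ 2 * ∑ i, c i ^ 2 * (Z i * W i) := by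
  have h00 := hr 0 0
  have h01 := hr 0 1
  have h11 := hr 1 1
  simp only [Fin.sum_univ_two, if_true, zero_ne_one, if_false] at *
  linear_combination k ^ 2 * (c 0 ^ 2 * Z 0 * W 0 * h00 + c 1 ^ 2 * Z 1 * W 1 * h11 +
    c 0 * c 1 * (Z 0 * W 1 + Z 1 * W 0) * h01)

/-- The form `rotForm ψ i` in the first set of variables, times the same form in the second. -/
def rotProd (ψ : ℝ) (i : Fin 2) : MvPolynomial Idx ℝ :=
  (∑ j, C (rot ψ i j) * X (Sum.inl j)) * ∑ j, C (rot ψ i j) * X (Sum.inr j)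

theorem pol_pderiv_sum_rotForm_pow (ψ : ℝ) (c : Fin 2 → ℝ) (a b : ℕ) (j : Fin 2) :
    pol a b (pderiv j (∑ i, C (c i) * rotForm ψ i ^ (a + b + 1))) =
      C (((a + b : ℕ) + 1) * ((a + b).choose a : ℝ)) * ∑ i, C (c i) * C (rot ψ i j) *
        ((∑ j, C (rot ψ i j) * X (Sum.inl j)) ^ a *
          (∑ j, C (rot ψ i j) * X (Sum.inr j)) ^ b) := by
  have h : ∀ i, pol a b (pderiv j (C (c i) * rotForm ψ i ^ (a + b + 1))) =
      C (((a + b : ℕ) + 1) * ((a + b).choose a : ℝ)) * (C (c i) * C (rot ψ i j) *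
        ((∑ j, C (rot ψ i j) * X (Sum.inl j)) ^ a *
          (∑ j, C (rot ψ i j) * X (Sum.inr j)) ^ b)) := by
    intro i
    rw [pderiv_C_mul, pderiv_rotForm_pow, pol_C_mul, pol_C_mul, rotForm, pol_linear_pow]
    simp only [map_mul]
    ring
  rw [Finset.mul_sum, ← Finset.sum_congr rfl fun i _ => h i, map_sum, Fin.sum_univ_two,
    Fin.sum_univ_two, pol_add]

/-- The product with swapped bidegrees turns ℓ(x)^a ℓ(y)^b into (ℓ(x) ℓ(y))^(a + b). Thus all
bidegrees give the same polynomial, and only the scalar depends on (a, b). -/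
theorem sum_pol_pderiv_mul_pol_pderiv (ψ : ℝ) (c : Fin 2 → ℝ) (a b : ℕ) :
    ∑ j : Fin 2, pol a b (pderiv j (∑ i, C (c i) * rotForm ψ i ^ (a + b + 1))) *
        pol b a (pderiv j (∑ i, C (c i) * rotForm ψ i ^ (a + b + 1))) =
      C (((a + b : ℕ) + 1) ^ 2 * ((a + b).choose a : ℝ) ^ 2) *
        ∑ i, C (c i ^ 2) * rotProd ψ i ^ (a + b) := by
  have ho : ∀ i k, ∑ j, (C (rot ψ i j) * C (rot ψ k j) : MvPolynomial Idx ℝ) =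
      if i = k then 1 else 0 := by
    intro i k
    have := congrArg (C : ℝ → MvPolynomial Idx ℝ) (rot_orthonormal ψ i k)
    rw [map_sum] at this
    simpa [apply_ite (C : ℝ → MvPolynomial Idx ℝ)] using this
  have e2 := pol_pderiv_sum_rotForm_pow ψ c b a
  rw [add_comm b a, show (a + b).choose b = (a + b).choose a from (Nat.choose_symm_add).symm] at e2
  simp only [pol_pderiv_sum_rotForm_pow ψ c a b, e2]
  rw [sum_mul_of_orthonormal ho, ← map_pow, mul_pow]
  refine congrArg _ (Finset.sum_congr rfl fun i _ => ?_)
  rw [rotProd, mul_pow, pow_add, pow_add, map_pow]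
  ring

theorem exists_polarizedMatch_of_isSplit {N : ℕ} (hN : Even N) (hN0 : N ≠ 0) {ψ : ℝ}
    {V : MvPolynomial (Fin 2) ℝ} (hV : V.IsHomogeneous (N + 1)) (h : IsSplit ψ V) :
    ∃ U : MvPolynomial (Fin 2) ℝ, U.IsHomogeneous (N + N) ∧ PolarizedMatch N V U ∧ IsSplit ψ U ∧
      (V ≠ 0 → U ≠ 0) := by
  obtain ⟨c, rfl⟩ := h.eq_sum_pow hV
  set S : ℝ := ∑ p ∈ antidiagonal N, (N.choose p.1 : ℝ) ^ 2 / (((p.1 : ℝ) - p.2) ^ 2 - 1) with hS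
  have hS0 : S ≠ 0 := (sum_choose_sq_div_sub_one_neg N hN).ne
  set B : ℝ := ((N + N).choose N : ℝ) with hB
  have hB0 : B ≠ 0 := by
    rw [hB]
    exact_mod_cast (Nat.choose_pos (Nat.le_add_right N N)).ne'
  -- The factor (N + 1)² comes from the gradient, S collects the scalars over all bidegrees, and B
  -- is the binomial in the polarization of a 2N-th power. It is nonzero because S is negative.
  set γ : ℝ := 1 / 2 * (N + 1) ^ 2 * S / B with hγ
  have hγ0 : γ ≠ 0 := by positivity
  have hC : ∀ r : ℝ, rotPoly ψ (C r) = C r := fun r => by simp [rotPoly]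
  refine ⟨∑ i, C (γ * c i ^ 2) * rotForm ψ i ^ (N + N), ?_, ?_, ?_, ?_⟩
  · refine IsHomogeneous.sum _ _ _ fun i _ => ?_
    have := ((rotForm_isHomogeneous ψ i).pow (N + N)).C_mul (γ * c i ^ 2)
    rwa [one_mul] at this
  · have hpolN : ∀ i, pol N N (rotForm ψ i ^ (N + N)) = C B * rotProd ψ i ^ N := by
      intro i
      rw [rotForm, pol_linear_pow, rotProd, mul_pow]
    have hsq : ∀ p ∈ antidiagonal N,
        ∑ j : Fin 2, pol p.1 p.2 (pderiv j (∑ i, C (c i) * rotForm ψ i ^ (N + 1))) *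
          pol p.2 p.1 (pderiv j (∑ i, C (c i) * rotForm ψ i ^ (N + 1))) =
        C ((N + 1) ^ 2 * (N.choose p.1 : ℝ) ^ 2) * ∑ i, C (c i ^ 2) * rotProd ψ i ^ N := by
      rintro ⟨a, b⟩ hp
      rw [HasAntidiagonal.mem_antidiagonal] at hp
      simp only at hp ⊢
      subst hp
      exact_mod_cast sum_pol_pderiv_mul_pol_pderiv ψ c a b
    rw [PolarizedMatch, Finset.sum_comm]
    simp only [← Finset.mul_sum]
    rw [Finset.sum_congr rfl fun p hp => congrArg _ (hsq p hp)]
    simp only [← mul_assoc, ← map_mul, ← Finset.sum_mul, ← map_sum]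
    have hS' : ∑ p ∈ antidiagonal N, 1 / (((p.1 : ℝ) - p.2) ^ 2 - 1) *
        (N + 1) ^ 2 * (N.choose p.1 : ℝ) ^ 2 = (N + 1) ^ 2 * S := by
      rw [hS, Finset.mul_sum]
      exact Finset.sum_congr rfl fun p _ => by ring
    rw [hS', Fin.sum_univ_two, Fin.sum_univ_two, pol_add, pol_C_mul, pol_C_mul, hpolN, hpolN,
      mul_add]
    simp only [← mul_assoc, ← map_mul]
    congr 3 <;> (rw [hγ]; field_simp)
  · simp [IsSplit, rotPoly_rotForm, hC, Fin.sum_univ_two, pderiv_X]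
  · intro hV0 hU0
    apply hV0
    have e := congrArg (rotPoly ψ) hU0
    simp only [Fin.sum_univ_two, map_add, map_mul, map_pow, rotPoly_rotForm, map_zero] at e
    have e0 := congrArg (eval ![1, 0]) e
    have e1 := congrArg (eval ![0, 1]) e
    simp [hN0, hγ0, hC] at e0 e1
    simp [Fin.sum_univ_two, e0, e1]

end PHO

end

/-! ### Spectral decomposition of D and the second-order term -/

noncomputable section

namespace PHO

open MvPolynomial Finset

/-! ### The operator `D` on polynomials and its diagonalization -/

/-- The operator `D` on polynomials. -/
def oscPolyD : Derivation ℝ (MvPolynomial Idx ℝ) (MvPolynomial Idx ℝ) :=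
  mkDerivation ℝ (Sum.elim (fun j => -X (Sum.inr j)) fun j => X (Sum.inl j))

theorem derivation_eq_sum_pderiv {σ R : Type*} [Fintype σ] [CommSemiring R]
    (d : Derivation R (MvPolynomial σ R) (MvPolynomial σ R)) (F : MvPolynomial σ R) :
    d F = ∑ k, pderiv k F * d (X k) := by
  simpa using derivation_aeval d X F

theorem oscPolyD_apply (F : MvPolynomial Idx ℝ) :
    oscPolyD F = ∑ j : Fin 2, (X (Sum.inl j) * pderiv (Sum.inr j) F
      - X (Sum.inr j) * pderiv (Sum.inl j) F) := by
  rw [derivation_eq_sum_pderiv, Fintype.sum_sum_type]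
  simp only [oscPolyD, mkDerivation_X, Sum.elim_inl, Sum.elim_inr, Finset.sum_sub_distrib,
    mul_neg, Finset.sum_neg_distrib]
  simp only [mul_comm]
  ring

theorem oscPolyD_isHomogeneous {n : ℕ} {F : MvPolynomial Idx ℝ} (hF : F.IsHomogeneous n) :
    (oscPolyD F).IsHomogeneous n := by
  rcases n with _ | n
  · have : F = C (coeff 0 F) :=
      totalDegree_eq_zero_iff_eq_C.mp ((totalDegree_zero_iff_isHomogeneous _).mpr hF)
    rw [this, derivation_C]
    exact isHomogeneous_zero _ _ _
  · rw [oscPolyD_apply]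
    refine IsHomogeneous.sum _ _ _ fun j _ => ?_
    have h : ∀ k l, (X k * pderiv l F : MvPolynomial Idx ℝ).IsHomogeneous (n + 1) := fun k l => by
      rw [add_comm]
      exact (isHomogeneous_X ℝ k).mul (pderiv_isHomogeneous hF l)
    exact (h _ _).sub (h _ _)

/-- The difference of the Euler operators of the two sets of variables. -/
def eulerDiff : Derivation ℂ (MvPolynomial Idx ℂ) (MvPolynomial Idx ℂ) :=
  mkDerivation ℂ (Sum.elim (fun j => X (Sum.inl j)) fun j => -X (Sum.inr j))

theorem coeff_eulerDiff (F : MvPolynomial Idx ℂ) (d : Idx →₀ ℕ) :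
    coeff d (eulerDiff F) =
      (((d (Sum.inl 0) + d (Sum.inl 1) : ℕ) : ℂ) - (d (Sum.inr 0) + d (Sum.inr 1) : ℕ)) *
        coeff d F := by
  classical
  induction F using MvPolynomial.induction_on' with
  | add p q hp hq => rw [map_add, coeff_add, hp, hq, coeff_add, mul_add]
  | monomial e r =>
    have h : eulerDiff (monomial e r) =
        (((e (Sum.inl 0) + e (Sum.inl 1) : ℕ) : ℂ) - (e (Sum.inr 0) + e (Sum.inr 1) : ℕ)) •
          monomial e r := by
      rw [derivation_eq_sum_pderiv, Fintype.sum_sum_type]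
      simp only [eulerDiff, mkDerivation_X, Sum.elim_inl, Sum.elim_inr, mul_neg,
        mul_comm _ (X _ : MvPolynomial Idx ℂ), X_mul_pderiv_monomial, Fin.sum_univ_two]
      simp only [← Nat.cast_smul_eq_nsmul ℂ, smul_monomial, ← map_add, ← map_neg, smul_eq_mul]
      congr 1
      push_cast
      ring
    rw [h, coeff_smul, smul_eq_mul, coeff_monomial]
    split_ifs with hed
    · rw [hed]
    · simp

theorem bicomp_eulerDiff (a b : ℕ) (F : MvPolynomial Idx ℂ) :
    bicomp a b (eulerDiff F) = C ((a : ℂ) - b) * bicomp a b F := by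
  ext d
  rw [coeff_C_mul, coeff_bicomp, coeff_bicomp, coeff_eulerDiff]
  split_ifs with h
  · rw [weight_bidegree, Prod.ext_iff] at h
    simp only at h
    rw [h.1, h.2]
  · simp

/-- The coordinates `q = x + y`, `η = -i (x - y)`, in which `D` is diagonal. -/
def diagonalize : MvPolynomial Idx ℝ →ₐ[ℝ] MvPolynomial Idx ℂ :=
  aeval (Sum.elim (fun j => X (Sum.inl j) + X (Sum.inr j))
    fun j => C (-Complex.I) * (X (Sum.inl j) - X (Sum.inr j)))

theorem diagonalize_isHomogeneous {n : ℕ} {F : MvPolynomial Idx ℝ} (hF : F.IsHomogeneous n) :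
    (diagonalize F).IsHomogeneous n := by
  have := hF.aeval (S := ℂ) (τ := Idx) (n := 1)
    (Sum.elim (fun j => X (Sum.inl j) + X (Sum.inr j))
      fun j => C (-Complex.I) * (X (Sum.inl j) - X (Sum.inr j))) (by
    rintro (j | j)
    · exact (isHomogeneous_X _ _).add (isHomogeneous_X _ _)
    · exact ((isHomogeneous_X _ _).sub (isHomogeneous_X _ _)).C_mul _)
  rw [one_mul] at this
  exact this

theorem diagonalize_oscPolyD (F : MvPolynomial Idx ℝ) :
    diagonalize (oscPolyD F) = C Complex.I * eulerDiff (diagonalize F) := by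
  have h := derivation_aeval (eulerDiff.restrictScalars ℝ)
    (Sum.elim (fun j => X (Sum.inl j) + X (Sum.inr j))
      fun j => C (-Complex.I) * (X (Sum.inl j) - X (Sum.inr j))) F
  rw [Derivation.restrictScalars_apply] at h
  change eulerDiff (diagonalize F) = ∑ k, diagonalize _ * _ at h
  rw [h, derivation_eq_sum_pderiv, map_sum, Finset.mul_sum]
  refine Finset.sum_congr rfl fun k _ => ?_
  have hI : C Complex.I * C Complex.I = (-1 : MvPolynomial Idx ℂ) := by
    rw [← map_mul, Complex.I_mul_I, map_neg, map_one]
  rw [map_mul, mul_left_comm]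
  congr 1
  rcases k with j | j
  · simp [oscPolyD, eulerDiff, mkDerivation_X, diagonalize]
    ring
  · simp [oscPolyD, eulerDiff, mkDerivation_X, diagonalize]
    linear_combination (X (Sum.inl j) + X (Sum.inr j)) * hI

/-- The components of bidegree (a, b) are eigenvectors of D with eigenvalue i (a - b); the
decomposition into kernel and image rests on this. -/
theorem bicomp_diagonalize_oscPolyD (a b : ℕ) (F : MvPolynomial Idx ℝ) :
    bicomp a b (diagonalize (oscPolyD F)) =
      C (Complex.I * ((a : ℂ) - b)) * bicomp a b (diagonalize F) := by
  rw [diagonalize_oscPolyD, ← smul_eq_C_mul, map_smul, bicomp_eulerDiff, smul_eq_C_mul, map_mul,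
    mul_assoc]

theorem diagonalize_injective : Function.Injective diagonalize := by
  -- The inverse change of variables x = ½ (q + iη), y = ½ (q - iη); it undoes `diagonalize` up to
  -- the inclusion of real in complex coefficients.
  set ψ : MvPolynomial Idx ℂ →ₐ[ℂ] MvPolynomial Idx ℂ :=
    aeval (Sum.elim (fun j => C (1 / 2) * (X (Sum.inl j) + C Complex.I * X (Sum.inr j)))
      fun j => C (1 / 2) * (X (Sum.inl j) - C Complex.I * X (Sum.inr j))) with hψ
  have hI : C Complex.I * C Complex.I = (-1 : MvPolynomial Idx ℂ) := by
    rw [← map_mul, Complex.I_mul_I, map_neg, map_one]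
  have h2 : C 2⁻¹ * 2 = (1 : MvPolynomial Idx ℂ) := by
    rw [show (2 : MvPolynomial Idx ℂ) = C 2 from (map_ofNat C 2).symm, ← map_mul]
    norm_num
  have hX : (ψ.restrictScalars ℝ).comp diagonalize = aeval X := by
    apply MvPolynomial.algHom_ext
    rintro (j | j)
    · simp [diagonalize, hψ]
      linear_combination X (Sum.inl j) * h2
    · simp [diagonalize, hψ, MvPolynomial.algebraMap_eq]
      linear_combination X (Sum.inr j) * h2 - 2 * C 2⁻¹ * X (Sum.inr j) * hI
  have h : ∀ F, ψ (diagonalize F) = map (algebraMap ℝ ℂ) F := by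
    intro F
    have h1 := DFunLike.congr_fun hX F
    rw [← aeval_map_algebraMap ℂ] at h1
    simpa using h1
  intro F G hFG
  apply map_injective (algebraMap ℝ ℂ) (algebraMap ℝ ℂ).injective
  rw [← h, ← h, hFG]

theorem pderiv_inl_diagonalize (j : Fin 2) (F : MvPolynomial Idx ℝ) :
    pderiv (Sum.inl j) (diagonalize F) = diagonalize (pderiv (Sum.inl j) F) -
      C Complex.I * diagonalize (pderiv (Sum.inr j) F) := by
  have h := derivation_aeval ((pderiv (Sum.inl j) : Derivation ℂ _ _).restrictScalars ℝ)
    (Sum.elim (fun j => X (Sum.inl j) + X (Sum.inr j))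
      fun j => C (-Complex.I) * (X (Sum.inl j) - X (Sum.inr j))) F
  rw [Derivation.restrictScalars_apply] at h
  change pderiv (Sum.inl j) (diagonalize F) = ∑ k, diagonalize _ * _ at h
  rw [h, Fintype.sum_sum_type]
  fin_cases j <;> simp [Fin.sum_univ_two, pderiv_X] <;> ring

theorem pderiv_inr_diagonalize (j : Fin 2) (F : MvPolynomial Idx ℝ) :
    pderiv (Sum.inr j) (diagonalize F) = diagonalize (pderiv (Sum.inl j) F) +
      C Complex.I * diagonalize (pderiv (Sum.inr j) F) := by
  have h := derivation_aeval ((pderiv (Sum.inr j) : Derivation ℂ _ _).restrictScalars ℝ)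
    (Sum.elim (fun j => X (Sum.inl j) + X (Sum.inr j))
      fun j => C (-Complex.I) * (X (Sum.inl j) - X (Sum.inr j))) F
  rw [Derivation.restrictScalars_apply] at h
  change pderiv (Sum.inr j) (diagonalize F) = ∑ k, diagonalize _ * _ at h
  rw [h, Fintype.sum_sum_type]
  fin_cases j <;> simp [Fin.sum_univ_two, pderiv_X] <;> ring

theorem diagonalize_rename_inl (V : MvPolynomial (Fin 2) ℝ) :
    diagonalize (rename Sum.inl V) = addSubst (map (algebraMap ℝ ℂ) V) := by
  rw [diagonalize, aeval_rename, addSubst, aeval_map_algebraMap]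
  rfl

/-! ### Decomposition into the kernel and the image of `D` -/

theorem bicomp_diagonalize_of_ker {F : MvPolynomial Idx ℝ} (h : oscPolyD F = 0) {a b : ℕ}
    (hab : a ≠ b) : bicomp a b (diagonalize F) = 0 := by
  have := bicomp_diagonalize_oscPolyD a b F
  rw [h, map_zero, map_zero, eq_comm, mul_eq_zero, C_eq_zero] at this
  refine this.resolve_left (mul_ne_zero Complex.I_ne_zero ?_)
  rw [sub_ne_zero]
  exact_mod_cast hab

theorem eq_zero_of_bicomp_diagonalize {n : ℕ} {F : MvPolynomial Idx ℝ} (hF : F.IsHomogeneous n)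
    (h : ∀ p ∈ antidiagonal n, bicomp p.1 p.2 (diagonalize F) = 0) : F = 0 := by
  apply diagonalize_injective
  rw [map_zero, ← sum_bicomp (diagonalize_isHomogeneous hF), Finset.sum_eq_zero h]

/-- When a + b is odd, a ≠ b, so zero is not an eigenvalue. -/
theorem eq_zero_of_oscPolyD_eq_zero_of_odd {n : ℕ} (hn : Odd n) {F : MvPolynomial Idx ℝ}
    (hF : F.IsHomogeneous n) (h : oscPolyD F = 0) : F = 0 := by
  refine eq_zero_of_bicomp_diagonalize hF fun p hp => bicomp_diagonalize_of_ker h ?_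
  rw [HasAntidiagonal.mem_antidiagonal] at hp
  rw [Nat.odd_iff] at hn
  omega

/-- Semisimplicity: the components with a = b are already killed by the first D, and on the others D
is invertible. -/
theorem oscPolyD_eq_zero_of_oscPolyD_oscPolyD {n : ℕ} {F : MvPolynomial Idx ℝ}
    (hF : F.IsHomogeneous n) (h : oscPolyD (oscPolyD F) = 0) : oscPolyD F = 0 := by
  refine eq_zero_of_bicomp_diagonalize (oscPolyD_isHomogeneous hF) fun p _ => ?_
  by_cases hp : p.1 = p.2
  · rw [bicomp_diagonalize_oscPolyD, hp, sub_self, mul_zero, map_zero, zero_mul]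
  · exact bicomp_diagonalize_of_ker h hp

/-- In the finite-dimensional space of forms of degree n, kernel and range of D meet trivially by
semisimplicity, so rank-nullity makes them complementary. This avoids constructing the projection
over ℝ. -/
theorem exists_ker_add_oscPolyD {n : ℕ} {F : MvPolynomial Idx ℝ} (hF : F.IsHomogeneous n) :
    ∃ g r : MvPolynomial Idx ℝ, g.IsHomogeneous n ∧ r.IsHomogeneous n ∧ oscPolyD g = 0 ∧
      F = g + oscPolyD r := by
  have : Module.Finite ℝ (homogeneousSubmodule Idx ℝ n) :=
    Module.Finite.iff_fg.mpr (homogeneousSubmodule_fg Idx ℝ n)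
  set L : homogeneousSubmodule Idx ℝ n →ₗ[ℝ] homogeneousSubmodule Idx ℝ n :=
    (oscPolyD : MvPolynomial Idx ℝ →ₗ[ℝ] MvPolynomial Idx ℝ).restrict
      fun _ hx => oscPolyD_isHomogeneous hx with hL
  have hdisj : Disjoint (LinearMap.ker L) (LinearMap.range L) := by
    rw [Submodule.disjoint_def]
    rintro _ hx ⟨y, rfl⟩
    rw [LinearMap.mem_ker] at hx
    have h2 := congrArg Subtype.val hx
    exact Subtype.ext (oscPolyD_eq_zero_of_oscPolyD_oscPolyD y.2 h2)
  have hcompl := (Submodule.isCompl_iff_disjoint (LinearMap.ker L) (LinearMap.range L)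
    (by rw [add_comm, LinearMap.finrank_range_add_finrank_ker])).mpr hdisj
  have hmem : (⟨F, hF⟩ : homogeneousSubmodule Idx ℝ n) ∈ LinearMap.ker L ⊔ LinearMap.range L := by
    rw [hcompl.sup_eq_top]
    trivial
  obtain ⟨g, hg, _, ⟨r, rfl⟩, e⟩ := Submodule.mem_sup.mp hmem
  exact ⟨g, r, g.2, r.2, congrArg Subtype.val hg, (congrArg Subtype.val e).symm⟩

theorem exists_oscPolyD_eq_of_odd {n : ℕ} (hn : Odd n) {F : MvPolynomial Idx ℝ}
    (hF : F.IsHomogeneous n) : ∃ r : MvPolynomial Idx ℝ, r.IsHomogeneous n ∧ oscPolyD r = F := by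
  obtain ⟨g, r, hg, hr, hg0, e⟩ := exists_ker_add_oscPolyD hF
  rw [eq_zero_of_oscPolyD_eq_zero_of_odd hn hg hg0, zero_add] at e
  exact ⟨r, hr, e.symm⟩

/-- The homological equation contains D w, and w itself must lie in the image of D; hence the second
D. -/
theorem exists_ker_add_oscPolyD_oscPolyD {n : ℕ} {F : MvPolynomial Idx ℝ}
    (hF : F.IsHomogeneous n) :
    ∃ g r : MvPolynomial Idx ℝ, g.IsHomogeneous n ∧ r.IsHomogeneous n ∧ oscPolyD g = 0 ∧
      F = g + oscPolyD (oscPolyD r) := by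
  obtain ⟨g, r, hg, hr, hg0, rfl⟩ := exists_ker_add_oscPolyD hF
  obtain ⟨g', r', hg', hr', hg0', rfl⟩ := exists_ker_add_oscPolyD hr
  exact ⟨g, r', hg, hr', hg0, by rw [map_add, hg0', zero_add]⟩

/-! ### The second-order part of the normal form -/

/-- The polynomial `½ (|∂w/∂q|² - |∂w/∂η|²)`. -/
def gradForm (w : MvPolynomial Idx ℝ) : MvPolynomial Idx ℝ :=
  C (1 / 2) * ∑ j : Fin 2, (pderiv (Sum.inl j) w ^ 2 - pderiv (Sum.inr j) w ^ 2)

theorem gradForm_isHomogeneous {n : ℕ} {w : MvPolynomial Idx ℝ} (hw : w.IsHomogeneous (n + 1)) :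
    (gradForm w).IsHomogeneous (n + n) := by
  refine (IsHomogeneous.sum _ _ _ fun j _ => ?_).C_mul _
  rw [← mul_two]
  exact ((pderiv_isHomogeneous hw _).pow 2).sub ((pderiv_isHomogeneous hw _).pow 2)

/-- The x- and y-derivatives are w_q ∓ i w_η, so their squares add up to 2 (w_q² - w_η²). -/
theorem diagonalize_gradForm (w : MvPolynomial Idx ℝ) :
    diagonalize (gradForm w) = C (1 / 4) * ∑ j : Fin 2,
      (pderiv (Sum.inl j) (diagonalize w) * pderiv (Sum.inl j) (diagonalize w) +
        pderiv (Sum.inr j) (diagonalize w) * pderiv (Sum.inr j) (diagonalize w)) := by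
  have hI : C Complex.I * C Complex.I = (-1 : MvPolynomial Idx ℂ) := by
    rw [← map_mul, Complex.I_mul_I, map_neg, map_one]
  have h2 : C (1 / 2) = (C (1 / 4) * 2 : MvPolynomial Idx ℂ) := by
    rw [show (2 : MvPolynomial Idx ℂ) = C 2 from (map_ofNat C 2).symm, ← map_mul]
    norm_num
  have hC : diagonalize (C (1 / 2)) = C (1 / 2) := by
    rw [diagonalize, aeval_C, MvPolynomial.algebraMap_apply]
    simp
  rw [gradForm, map_mul, hC, h2, map_sum, mul_assoc, Finset.mul_sum]
  congr 1
  refine Finset.sum_congr rfl fun j _ => ?_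
  rw [pderiv_inl_diagonalize, pderiv_inr_diagonalize, map_sub, map_pow, map_pow]
  linear_combination -2 * diagonalize (pderiv (Sum.inr j) w) ^ 2 * hI

theorem bicomp_sum_pol_mul_sum_pol (N : ℕ) (α : ℕ → ℕ → ℂ) (f : MvPolynomial (Fin 2) ℂ) :
    bicomp N N ((∑ p ∈ antidiagonal N, C (α p.1 p.2) * pol p.1 p.2 f) *
      ∑ p ∈ antidiagonal N, C (α p.1 p.2) * pol p.1 p.2 f) =
    ∑ p ∈ antidiagonal N, C (α p.1 p.2 * α p.2 p.1) * (pol p.1 p.2 f * pol p.2 p.1 f) := by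
  rw [Finset.sum_mul_sum, map_sum]
  refine Finset.sum_congr rfl fun p hp => ?_
  -- Bidegrees (a, b) and (c, d) of total degree N add to (N, N) only if (c, d) = (b, a).
  rw [map_sum, Finset.sum_eq_single p.swap]
  · have e : C (α p.1 p.2) * pol p.1 p.2 f * (C (α p.swap.1 p.swap.2) * pol p.swap.1 p.swap.2 f) =
        (α p.1 p.2 * α p.2 p.1) • (pol p.1 p.2 f * pol p.2 p.1 f) := by
      rw [smul_eq_C_mul, map_mul]
      simp only [Prod.fst_swap, Prod.snd_swap]
      ring
    rw [e, map_smul, bicomp_mul_of_bihomogeneous (pol_bihomogeneous _ _ _) (pol_bihomogeneous _ _ _),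
      if_pos, smul_eq_C_mul]
    rw [HasAntidiagonal.mem_antidiagonal] at hp
    ext <;> simp <;> omega
  · intro q _ hq
    have e : C (α p.1 p.2) * pol p.1 p.2 f * (C (α q.1 q.2) * pol q.1 q.2 f) =
        (α p.1 p.2 * α q.1 q.2) • (pol p.1 p.2 f * pol q.1 q.2 f) := by
      rw [smul_eq_C_mul, map_mul]
      ring
    rw [e, map_smul, bicomp_mul_of_bihomogeneous (pol_bihomogeneous _ _ _) (pol_bihomogeneous _ _ _),
      if_neg, smul_zero]
    intro h
    apply hq
    rw [HasAntidiagonal.mem_antidiagonal] at hp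
    rw [Prod.ext_iff] at h ⊢
    simp at h ⊢
    omega
  · intro h
    refine absurd ?_ h
    rw [HasAntidiagonal.mem_antidiagonal] at hp ⊢
    simp only [Prod.fst_swap, Prod.snd_swap]
    omega

/-- Solving D w = V divides the (a, b) component of V(x + y) by i (a - b). After differentiation,
the paired components in x have coefficient 1 / (i (a - b + 1)) · 1 / (i (b - a + 1)) = 1 / ((a -
b)² - 1), and those in y the same; the factor ¼ becomes ½. -/
theorem bicomp_diagonalize_gradForm {N : ℕ} (hN : Even N) {V : MvPolynomial (Fin 2) ℝ}
    {w : MvPolynomial Idx ℝ} (hw : w.IsHomogeneous (N + 1)) (h : oscPolyD w = rename Sum.inl V) :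
    bicomp N N (diagonalize (gradForm w)) = map (algebraMap ℝ ℂ) (C (1 / 2) * ∑ j : Fin 2,
      ∑ p ∈ antidiagonal N, C (1 / (((p.1 : ℝ) - p.2) ^ 2 - 1)) *
      (pol p.1 p.2 (pderiv j V) * pol p.2 p.1 (pderiv j V))) := by
  set f := map (algebraMap ℝ ℂ) V with hf
  have hodd : ∀ a b : ℕ, a + b = N → ∀ k : ℤ, Odd k → ((a : ℂ) - b + k) ≠ 0 := by
    intro a b hab k hk h0
    have : (a : ℤ) - b + k = 0 := by exact_mod_cast h0
    rw [Nat.even_iff] at hN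
    rw [Int.odd_iff] at hk
    omega
  have hw1 : diagonalize w =
      ∑ p ∈ antidiagonal (N + 1), C (1 / (Complex.I * ((p.1 : ℂ) - p.2))) * pol p.1 p.2 f := by
    rw [← sum_bicomp (diagonalize_isHomogeneous hw)]
    refine Finset.sum_congr rfl fun p hp => ?_
    rw [pol, hf, ← diagonalize_rename_inl, ← h, bicomp_diagonalize_oscPolyD, ← mul_assoc, ← map_mul,
      one_div_mul_cancel, map_one, one_mul]
    refine mul_ne_zero Complex.I_ne_zero ?_
    rw [HasAntidiagonal.mem_antidiagonal] at hp
    rw [sub_ne_zero]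
    intro h0
    have : p.1 = p.2 := by exact_mod_cast h0
    rw [Nat.even_iff] at hN
    omega
  have hx : ∀ j, pderiv (Sum.inl j) (diagonalize w) = ∑ p ∈ antidiagonal N,
      C (1 / (Complex.I * ((p.1 + 1 : ℕ) - p.2))) * pol p.1 p.2 (pderiv j f) := by
    intro j
    rw [hw1, map_sum, Finset.Nat.sum_antidiagonal_succ]
    simp [pderiv_inl_pol_zero, pderiv_inl_pol_succ]
  have hy : ∀ j, pderiv (Sum.inr j) (diagonalize w) = ∑ p ∈ antidiagonal N,
      C (1 / (Complex.I * (p.1 - (p.2 + 1 : ℕ)))) * pol p.1 p.2 (pderiv j f) := by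
    intro j
    rw [hw1, map_sum, Finset.Nat.sum_antidiagonal_succ']
    simp [pderiv_inr_pol_zero, pderiv_inr_pol_succ]
  rw [diagonalize_gradForm, ← smul_eq_C_mul, map_smul, map_sum]
  simp only [hx, hy, map_add,
    bicomp_sum_pol_mul_sum_pol N (fun a b => 1 / (Complex.I * ((a + 1 : ℕ) - b))),
    bicomp_sum_pol_mul_sum_pol N (fun a b => 1 / (Complex.I * (a - (b + 1 : ℕ))))]
  rw [smul_eq_C_mul, map_mul, map_C, map_sum, Finset.mul_sum, Finset.mul_sum]
  refine Finset.sum_congr rfl fun j _ => ?_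
  rw [map_sum, ← Finset.sum_add_distrib, Finset.mul_sum, Finset.mul_sum]
  refine Finset.sum_congr rfl fun p hp => ?_
  rw [HasAntidiagonal.mem_antidiagonal] at hp
  rw [(map (algebraMap ℝ ℂ)).map_mul, (map (algebraMap ℝ ℂ)).map_mul, map_C, map_pol, map_pol,
    ← pderiv_map, ← hf, ← add_mul, ← map_add]
  simp only [← mul_assoc, ← map_mul (C : ℂ →+* MvPolynomial Idx ℂ)]
  congr 3
  have d1 := hodd p.1 p.2 hp 1 (by decide)
  have d2 := hodd p.1 p.2 hp (-1) (by decide)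
  push_cast at d1 d2
  have f1 : ((p.2 + 1 : ℕ) : ℂ) - p.1 = -((p.1 : ℂ) - p.2 + -1) := by push_cast; ring
  have f2 : ((p.2 : ℂ) - (p.1 + 1 : ℕ)) = -((p.1 : ℂ) - p.2 + 1) := by push_cast; ring
  have f3 : ((p.1 + 1 : ℕ) : ℂ) - p.2 = ((p.1 : ℂ) - p.2 + 1) := by push_cast; ring
  have f4 : ((p.1 : ℂ) - (p.2 + 1 : ℕ)) = ((p.1 : ℂ) - p.2 + -1) := by push_cast; ring
  have f5 : algebraMap ℝ ℂ (1 / (((p.1 : ℝ) - p.2) ^ 2 - 1)) =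
      1 / (((p.1 : ℂ) - p.2 + 1) * ((p.1 : ℂ) - p.2 + -1)) := by
    rw [show ((p.1 : ℂ) - p.2 + 1) * ((p.1 : ℂ) - p.2 + -1) = ((p.1 : ℂ) - p.2) ^ 2 - 1 by ring]
    simp
  have hI := Complex.I_sq
  have hI0 := Complex.I_ne_zero
  rw [f1, f2, f3, f4, f5]
  simp only [one_div, map_inv₀, map_ofNat]
  field_simp
  rw [hI]
  ring

/-- There are `w` and `r` with `D w = V` and `½ (|∂w/∂q|² - |∂w/∂η|²) - U = D r`. -/
def HomologicalMatch (N : ℕ) (V U : MvPolynomial (Fin 2) ℝ) : Prop :=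
  ∃ w r : MvPolynomial Idx ℝ, w.IsHomogeneous (N + 1) ∧ r.IsHomogeneous (N + N) ∧
    oscPolyD w = rename Sum.inl V ∧ oscPolyD r = gradForm w - rename Sum.inl U

/-- Image of D means vanishing kernel part, and in degree 2N the kernel part is the component of
bidegree (N, N). In odd degree N + 1 the equation D w = V is always solvable. -/
theorem homologicalMatch_iff {N : ℕ} (hN : Even N) {V U : MvPolynomial (Fin 2) ℝ}
    (hV : V.IsHomogeneous (N + 1)) (hU : U.IsHomogeneous (N + N)) :
    HomologicalMatch N V U ↔ PolarizedMatch N V U := by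
  have hinj := map_injective (σ := Idx) (algebraMap ℝ ℂ) (algebraMap ℝ ℂ).injective
  constructor
  · rintro ⟨w, r, hw, -, hwV, hr⟩
    have e := bicomp_diagonalize_oscPolyD N N r
    rw [hr, sub_self, mul_zero, map_zero, zero_mul, map_sub, map_sub, diagonalize_rename_inl,
      bicomp_diagonalize_gradForm hN hw hwV, sub_eq_zero] at e
    apply hinj
    rw [e, map_pol, pol]
  · intro h
    obtain ⟨w, hw, hwV⟩ := exists_oscPolyD_eq_of_odd hN.add_one
      (hV.rename_isHomogeneous (f := (Sum.inl : Fin 2 → Idx)))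
    have hU' := hU.rename_isHomogeneous (f := (Sum.inl : Fin 2 → Idx))
    obtain ⟨g, r, hg, hr, hg0, e⟩ := exists_ker_add_oscPolyD ((gradForm_isHomogeneous hw).sub hU')
    refine ⟨w, r, hw, hr, hwV, ?_⟩
    suffices g = 0 by rw [e, this, zero_add]
    refine eq_zero_of_bicomp_diagonalize hg fun p hp => ?_
    by_cases hpp : p.1 = p.2
    · have hpN : p.1 = N ∧ p.2 = N := by
        rw [HasAntidiagonal.mem_antidiagonal] at hp
        omega
      rw [hpN.1, hpN.2]
      have e2 := congrArg (fun F => bicomp N N (diagonalize F)) e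
      simp only [map_sub, map_add] at e2
      rw [bicomp_diagonalize_oscPolyD, sub_self, mul_zero, map_zero, zero_mul, add_zero,
        bicomp_diagonalize_gradForm hN hw hwV, diagonalize_rename_inl] at e2
      rw [← e2, sub_eq_zero, ← h, map_pol, pol]
    · exact bicomp_diagonalize_of_ker hg0 hpp

end PHO

end

/-! ### Formal power series: orders, substitutions, homogeneous parts -/

noncomputable section

namespace PHO

/-! ### Orders of formal power series -/

section Order

open MvPowerSeries

variable {σ R : Type*} [CommRing R] {n m : ℕ} {F G : MvPowerSeries σ R}

theorem le_order_add (hF : (n : ℕ∞) ≤ F.order) (hG : (n : ℕ∞) ≤ G.order) :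
    (n : ℕ∞) ≤ (F + G).order :=
  (le_min hF hG).trans min_order_le_add

theorem le_order_sub (hF : (n : ℕ∞) ≤ F.order) (hG : (n : ℕ∞) ≤ G.order) :
    (n : ℕ∞) ≤ (F - G).order := by
  rw [sub_eq_add_neg]
  exact le_order_add hF (by rwa [order_neg])

theorem le_order_mul_of_le (hF : (n : ℕ∞) ≤ F.order) (hG : (m : ℕ∞) ≤ G.order) :
    ((n + m : ℕ) : ℕ∞) ≤ (F * G).order := by
  push_cast
  exact (add_le_add hF hG).trans le_order_mul

theorem le_order_of_le (hF : (n : ℕ∞) ≤ F.order) (h : m ≤ n) : (m : ℕ∞) ≤ F.order :=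
  (by exact_mod_cast h : (m : ℕ∞) ≤ n).trans hF

theorem le_order_sum {ι : Type*} (s : Finset ι) {f : ι → MvPowerSeries σ R}
    (h : ∀ i ∈ s, (n : ℕ∞) ≤ (f i).order) : (n : ℕ∞) ≤ (∑ i ∈ s, f i).order := by
  classical
  induction s using Finset.induction_on with
  | empty => simp
  | insert i s hi ih =>
    rw [Finset.sum_insert hi]
    exact le_order_add (h i (Finset.mem_insert_self i s))
      (ih fun j hj => h j (Finset.mem_insert_of_mem hj))

theorem le_order_X (i : σ) : ((1 : ℕ) : ℕ∞) ≤ (X i : MvPowerSeries σ R).order := by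
  rw [Nat.cast_one, one_le_order_iff_constCoeff_eq_zero]
  simp

theorem le_order_pderiv (i : σ) (hF : ((n + 1 : ℕ) : ℕ∞) ≤ F.order) :
    (n : ℕ∞) ≤ (pderiv R i F).order := by
  refine nat_le_order fun d hd => ?_
  rw [coeff_pderiv, coeff_of_lt_order, zero_mul]
  refine lt_of_lt_of_le ?_ hF
  rw [map_add, Finsupp.degree_single]
  exact_mod_cast Nat.succ_lt_succ hd

theorem eq_zero_of_forall_le_order (h : ∀ n : ℕ, (n : ℕ∞) ≤ F.order) : F = 0 := by
  ext d
  rw [coeff_of_lt_order, coeff_zero]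
  exact lt_of_lt_of_le (by exact_mod_cast Nat.lt_succ_self d.degree) (h (d.degree + 1))

end Order

/-! ### Substitutions tangent to the identity -/

section NearIdentity

open MvPowerSeries

variable {σ R : Type*} [CommRing R]

theorem le_order_mul_sub_mul {n m : ℕ} {u v u' v' : MvPowerSeries σ R}
    (hv : (n : ℕ∞) ≤ v.order) (hu' : (m : ℕ∞) ≤ u'.order)
    (h : ((n + 1 : ℕ) : ℕ∞) ≤ (u - v).order) (h' : ((m + 1 : ℕ) : ℕ∞) ≤ (u' - v').order) :
    ((n + m + 1 : ℕ) : ℕ∞) ≤ (u * u' - v * v').order := by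
  have e : u * u' - v * v' = (u - v) * u' + v * (u' - v') := by ring
  rw [e]
  refine le_order_add ?_ (le_order_of_le (le_order_mul_of_le hv h') (by omega))
  exact le_order_of_le (le_order_mul_of_le h hu') (by omega)

variable {a : σ → MvPowerSeries σ R}

theorem le_order_sub_homogeneousComponent {n : ℕ} {F : MvPowerSeries σ R}
    (hF : (n : ℕ∞) ≤ F.order) : ((n + 1 : ℕ) : ℕ∞) ≤ (F - homogeneousComponent n F).order := by
  refine nat_le_order fun d hd => ?_
  rw [map_sub, coeff_homogeneousComponent]
  split_ifs with h
  · rw [sub_self]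
  · rw [sub_zero]
    exact coeff_of_lt_order (lt_of_lt_of_le (by exact_mod_cast (by omega : d.degree < n)) hF)

theorem le_order_homogeneousComponent (n : ℕ) (F : MvPowerSeries σ R) :
    (n : ℕ∞) ≤ (homogeneousComponent n F).order := by
  refine nat_le_order fun d hd => ?_
  rw [coeff_homogeneousComponent, if_neg hd.ne]

/-- Replacing X i by a i in one factor changes a product only in order one higher. The first two
bounds are carried along to make the induction multiplicative. -/
theorem le_order_monomial_sub_monomial (ha : ∀ i, ((2 : ℕ) : ℕ∞) ≤ (a i - X i).order)
    (e : σ →₀ ℕ) :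
    (e.degree : ℕ∞) ≤ (e.prod fun i k => a i ^ k).order ∧
      (e.degree : ℕ∞) ≤ (e.prod fun i k => (X i : MvPowerSeries σ R) ^ k).order ∧
      ((e.degree + 1 : ℕ) : ℕ∞) ≤
        (e.prod (fun i k => a i ^ k) - e.prod fun i k => (X i : MvPowerSeries σ R) ^ k).order := by
  classical
  induction e using Finsupp.induction_linear with
  | zero => simp
  | add f g hf hg =>
    rw [map_add, Finsupp.prod_add_index' (by simp) (by simp [pow_add]),
      Finsupp.prod_add_index' (by simp) (by simp [pow_add])]
    exact ⟨le_order_mul_of_le hf.1 hg.1, le_order_mul_of_le hf.2.1 hg.2.1,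
      le_order_mul_sub_mul hf.2.1 hg.1 hf.2.2 hg.2.2⟩
  | single i k =>
    rw [Finsupp.prod_single_index (by simp), Finsupp.prod_single_index (by simp),
      Finsupp.degree_single]
    have hX := le_order_X (R := R) i
    have h1 : ((1 : ℕ) : ℕ∞) ≤ (a i).order := by
      have := le_order_add (le_order_of_le (ha i) one_le_two) hX
      rwa [sub_add_cancel] at this
    induction k with
    | zero => simp
    | succ k ih =>
      simp only [pow_succ]
      exact ⟨le_order_mul_of_le ih.1 h1, le_order_mul_of_le ih.2.1 hX,
        le_order_mul_sub_mul ih.2.1 h1 ih.2.2 (ha i)⟩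

/-- Successive approximations to the solution of `subst a F = T`. -/
def substApprox (a : σ → MvPowerSeries σ R) (T : MvPowerSeries σ R) : ℕ → MvPowerSeries σ R
  | 0 => 0
  | n + 1 => substApprox a T n + homogeneousComponent n (T - subst a (substApprox a T n))

theorem coeff_substApprox (T : MvPowerSeries σ R) (d : σ →₀ ℕ) (n : ℕ) :
    coeff d (substApprox a T (d.degree + 1 + n)) = coeff d (substApprox a T (d.degree + 1)) := by
  induction n with
  | zero => rfl
  | succ n ih =>
    rw [← add_assoc, substApprox, map_add, ih, coeff_homogeneousComponent, if_neg (by omega),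
      add_zero]

variable [Finite σ]

theorem hasSubst_of_near_identity (ha : ∀ i, ((2 : ℕ) : ℕ∞) ≤ (a i - X i).order) : HasSubst a := by
  refine hasSubst_of_constantCoeff_zero fun i => ?_
  have h1 : ((1 : ℕ) : ℕ∞) ≤ (a i).order := by
    have := le_order_add (le_order_of_le (ha i) one_le_two) (le_order_X i)
    rwa [sub_add_cancel] at this
  rw [← one_le_order_iff_constCoeff_eq_zero]
  exact_mod_cast h1

theorem le_order_subst_sub_self (ha : ∀ i, ((2 : ℕ) : ℕ∞) ≤ (a i - X i).order) {n : ℕ}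
    {F : MvPowerSeries σ R} (hF : (n : ℕ∞) ≤ F.order) :
    ((n + 1 : ℕ) : ℕ∞) ≤ (subst a F - F).order := by
  refine nat_le_order fun d hd => ?_
  rw [map_sub, sub_eq_zero, coeff_subst (hasSubst_of_near_identity ha)]
  have hF' := coeff_subst (HasSubst.X (σ := σ) (S := R)) F d
  rw [subst_self, id] at hF'
  rw [hF']
  refine finsum_congr fun e => ?_
  by_cases he : e.degree < n
  · rw [coeff_of_lt_order (lt_of_lt_of_le (by exact_mod_cast he) hF), zero_smul, zero_smul]
  · congr 1
    rw [← sub_eq_zero, ← map_sub]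
    refine coeff_of_lt_order (lt_of_lt_of_le ?_ (le_order_monomial_sub_monomial ha e).2.2)
    exact_mod_cast (by omega : d.degree < e.degree + 1)

theorem le_order_subst_of_near_identity (ha : ∀ i, ((2 : ℕ) : ℕ∞) ≤ (a i - X i).order) {n : ℕ}
    {F : MvPowerSeries σ R} (hF : (n : ℕ∞) ≤ F.order) : (n : ℕ∞) ≤ (subst a F).order := by
  have := le_order_add (le_order_of_le (le_order_subst_sub_self ha hF) n.le_succ) hF
  rwa [sub_add_cancel] at this

/-- Adding the lowest part of the error to the approximation cancels it, because the substitution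
fixes lowest-order parts and perturbs only higher ones. -/
theorem le_order_sub_subst_substApprox (ha : ∀ i, ((2 : ℕ) : ℕ∞) ≤ (a i - X i).order)
    (T : MvPowerSeries σ R) (n : ℕ) :
    (n : ℕ∞) ≤ (T - subst a (substApprox a T n)).order := by
  induction n with
  | zero => simp
  | succ n ih =>
    set E := T - subst a (substApprox a T n) with hE
    have e : T - subst a (substApprox a T (n + 1)) =
        (E - homogeneousComponent n E) -
          (subst a (homogeneousComponent n E) - homogeneousComponent n E) := by
      rw [substApprox, subst_add (hasSubst_of_near_identity ha), ← hE]
      rw [hE]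
      ring
    rw [e]
    exact le_order_sub (le_order_sub_homogeneousComponent ih)
      (le_order_subst_sub_self ha (le_order_homogeneousComponent n E))

/-- A substitution tangent to the identity is surjective. -/
theorem exists_subst_eq (ha : ∀ i, ((2 : ℕ) : ℕ∞) ≤ (a i - X i).order) (T : MvPowerSeries σ R) :
    ∃ F : MvPowerSeries σ R, subst a F = T := by
  -- The coefficient at d is constant from step `d.degree + 1` on, so reading it there gives the
  -- formal limit.
  set F : MvPowerSeries σ R := fun d => coeff d (substApprox a T (d.degree + 1)) with hF
  have hFn : ∀ n : ℕ, (n : ℕ∞) ≤ (F - substApprox a T n).order := by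
    intro n
    refine nat_le_order fun d hd => ?_
    obtain ⟨k, rfl⟩ : ∃ k, n = d.degree + 1 + k := ⟨n - (d.degree + 1), by omega⟩
    rw [map_sub, coeff_substApprox, sub_eq_zero]
    rfl
  refine ⟨F, ?_⟩
  rw [← sub_eq_zero]
  refine eq_zero_of_forall_le_order fun n => ?_
  have e : subst a F - T = subst a (F - substApprox a T n) - (T - subst a (substApprox a T n)) := by
    rw [subst_sub (hasSubst_of_near_identity ha)]
    ring
  rw [e]
  exact le_order_sub (le_order_subst_of_near_identity ha (hFn n))
    (le_order_sub_subst_substApprox ha T n)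

end NearIdentity

/-! ### Homogeneous parts -/

section HomPart

theorem homPart_eq_homogeneousComponent (k : ℕ) (F : Series) :
    homPart k F = MvPowerSeries.homogeneousComponent k F := by
  ext d
  rw [MvPowerSeries.coeff_homogeneousComponent]
  rfl

theorem coeff_homPart (k : ℕ) (F : Series) (d : Idx →₀ ℕ) :
    MvPowerSeries.coeff d (homPart k F) =
      if d.degree = k then MvPowerSeries.coeff d F else 0 := rfl

theorem homPart_add (k : ℕ) (F G : Series) : homPart k (F + G) = homPart k F + homPart k G := by
  simp [homPart_eq_homogeneousComponent]

theorem homPart_sub (k : ℕ) (F G : Series) : homPart k (F - G) = homPart k F - homPart k G := by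
  simp [homPart_eq_homogeneousComponent]

theorem le_order_iff_homPart (n : ℕ) (F : Series) :
    (n : ℕ∞) ≤ F.order ↔ ∀ k < n, homPart k F = 0 := by
  constructor
  · intro h k hk
    ext d
    rw [coeff_homPart, map_zero]
    split_ifs with hd
    · refine MvPowerSeries.coeff_of_lt_order (lt_of_lt_of_le ?_ h)
      exact_mod_cast hd.trans_lt hk
    · rfl
  · intro h
    refine MvPowerSeries.nat_le_order fun d hd => ?_
    have := congrArg (MvPowerSeries.coeff d) (h d.degree hd)
    rwa [coeff_homPart, if_pos rfl, map_zero] at this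

theorem homPart_eq_zero_of_le_order {n k : ℕ} {F : Series} (h : (n : ℕ∞) ≤ F.order) (hk : k < n) :
    homPart k F = 0 :=
  (le_order_iff_homPart n F).mp h k hk

theorem homPart_coe {k n : ℕ} {p : MvPolynomial Idx ℝ} (hp : p.IsHomogeneous n) :
    homPart k (p : Series) = if k = n then (p : Series) else 0 := by
  ext d
  rw [coeff_homPart, MvPolynomial.coeff_coe]
  split_ifs with h1 h2 h2
  · rw [MvPolynomial.coeff_coe]
  · rw [hp.coeff_eq_zero (by omega), map_zero]
  · rw [MvPolynomial.coeff_coe, hp.coeff_eq_zero (by omega)]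
  · rw [map_zero]

theorem homPart_coe_self {n : ℕ} {p : MvPolynomial Idx ℝ} (hp : p.IsHomogeneous n) :
    homPart n (p : Series) = p := by
  rw [homPart_coe hp, if_pos rfl]

theorem le_order_coe {n : ℕ} {p : MvPolynomial Idx ℝ} (hp : p.IsHomogeneous n) :
    (n : ℕ∞) ≤ (p : Series).order := by
  rw [le_order_iff_homPart]
  intro k hk
  rw [homPart_coe hp, if_neg hk.ne]

theorem exists_coe_eq_homPart (k : ℕ) (F : Series) :
    ∃ p : MvPolynomial Idx ℝ, p.IsHomogeneous k ∧ (p : Series) = homPart k F := by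
  classical
  have hfin : {d : Idx →₀ ℕ | d.degree = k}.Finite := by
    have := Finsupp.finite_of_degree_le (σ := Idx) k
    exact this.subset fun d hd => le_of_eq hd
  refine ⟨∑ d ∈ hfin.toFinset, MvPolynomial.monomial d (MvPowerSeries.coeff d F), ?_, ?_⟩
  · refine MvPolynomial.IsHomogeneous.sum _ _ _ fun d hd => ?_
    exact MvPolynomial.isHomogeneous_monomial _ (by simpa using hd)
  · ext d
    rw [MvPolynomial.coeff_coe, MvPolynomial.coeff_sum, coeff_homPart]
    simp only [MvPolynomial.coeff_monomial]
    rw [Finset.sum_ite_eq']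
    simp

theorem coe_sub (p q : MvPolynomial Idx ℝ) : ((p - q : MvPolynomial Idx ℝ) : Series) = p - q :=
  map_sub MvPolynomial.coeToMvPowerSeries.ringHom p q

theorem oscD_coe (p : MvPolynomial Idx ℝ) : oscD (p : Series) = (oscPolyD p : Series) := by
  rw [oscD, oscPolyD_apply]
  simp only [Fin.sum_univ_two, MvPolynomial.coe_add, coe_sub, MvPolynomial.coe_mul,
    MvPolynomial.coe_X, MvPowerSeries.pderiv_coe]

theorem oscD_add (F G : Series) : oscD (F + G) = oscD F + oscD G := by
  simp only [oscD, map_add, mul_add, ← Finset.sum_add_distrib]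
  exact Finset.sum_congr rfl fun j _ => by ring

theorem le_order_oscD {n : ℕ} {F : Series} (h : (n : ℕ∞) ≤ F.order) :
    (n : ℕ∞) ≤ (oscD F).order := by
  rcases n with _ | n
  · simp
  · refine le_order_sum _ fun j _ => ?_
    have hX : ∀ i k, ((n + 1 : ℕ) : ℕ∞) ≤
        (MvPowerSeries.X i * MvPowerSeries.pderiv ℝ k F : Series).order := fun i k =>
      le_order_of_le (le_order_mul_of_le (le_order_X i) (le_order_pderiv k h)) (by omega)
    exact le_order_sub (hX _ _) (hX _ _)

theorem homPart_homPart (j k : ℕ) (F : Series) :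
    homPart j (homPart k F) = if j = k then homPart k F else 0 := by
  obtain ⟨p, hp, e⟩ := exists_coe_eq_homPart k F
  rw [← e, homPart_coe hp]

theorem homPart_sum (k : ℕ) {ι : Type*} (s : Finset ι) (f : ι → Series) :
    homPart k (∑ i ∈ s, f i) = ∑ i ∈ s, homPart k (f i) := by
  simp [homPart_eq_homogeneousComponent]

theorem oscD_sum {ι : Type*} (s : Finset ι) (f : ι → Series) :
    oscD (∑ i ∈ s, f i) = ∑ i ∈ s, oscD (f i) :=
  map_sum (⟨⟨oscD, by simp [oscD]⟩, oscD_add⟩ : Series →+ Series) f s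

/-- D preserves the degree of forms and does not lower the order, so the series may be replaced by
its truncation at degree k. -/
theorem homPart_oscD (k : ℕ) (F : Series) : homPart k (oscD F) = oscD (homPart k F) := by
  set S : Series := ∑ j ∈ Finset.range (k + 1), homPart j F with hS
  have hT : ((k + 1 : ℕ) : ℕ∞) ≤ (F - S).order := by
    rw [le_order_iff_homPart]
    intro i hi
    rw [homPart_sub, hS, homPart_sum]
    simp only [homPart_homPart]
    rw [Finset.sum_ite_eq, if_pos (Finset.mem_range.mpr hi), sub_self]
  have e : oscD F = oscD (F - S) + oscD S := by rw [← oscD_add, sub_add_cancel]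
  rw [e, homPart_add, homPart_eq_zero_of_le_order (le_order_oscD hT) k.lt_succ_self, zero_add, hS,
    oscD_sum, homPart_sum, Finset.sum_eq_single k]
  · obtain ⟨p, hp, e⟩ := exists_coe_eq_homPart k F
    rw [← e, oscD_coe, homPart_coe_self (oscPolyD_isHomogeneous hp)]
  · intro j _ hj
    obtain ⟨p, hp, e⟩ := exists_coe_eq_homPart j F
    rw [← e, oscD_coe, homPart_coe (oscPolyD_isHomogeneous hp), if_neg hj.symm]
  · simp

end HomPart

end PHO

end

/-! ### Reduction of shared normal forms to a finite homological equation -/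

noncomputable section

namespace PHO

/-! ### The homological equation of the Birkhoff-Gustavson normalization -/

/-- The generating function `∑ⱼ qⱼ ηⱼ` of the identity. -/
def genIdPoly : MvPolynomial Idx ℝ :=
  ∑ j : Fin 2, MvPolynomial.X (Sum.inl j) * MvPolynomial.X (Sum.inr j)

theorem genIdPoly_isHomogeneous : genIdPoly.IsHomogeneous 2 :=
  MvPolynomial.IsHomogeneous.sum _ _ _ fun _ _ =>
    (MvPolynomial.isHomogeneous_X _ _).mul (MvPolynomial.isHomogeneous_X _ _)

theorem osc_isHomogeneous : osc.IsHomogeneous 2 := by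
  refine (MvPolynomial.IsHomogeneous.sum _ _ _ fun j _ => ?_).C_mul _
  exact ((MvPolynomial.isHomogeneous_X _ _).pow 2).add ((MvPolynomial.isHomogeneous_X _ _).pow 2)

theorem coe_genIdPoly :
    (genIdPoly : Series) =
      ∑ j : Fin 2, MvPowerSeries.X (Sum.inl j) * MvPowerSeries.X (Sum.inr j) := by
  simp only [genIdPoly, Fin.sum_univ_two, MvPolynomial.coe_add, MvPolynomial.coe_mul,
    MvPolynomial.coe_X]

theorem le_order_sub_coe_iff {p : MvPolynomial Idx ℝ} (hp : p.IsHomogeneous 2) (F : Series) :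
    ((3 : ℕ) : ℕ∞) ≤ (F - p).order ↔
      homPart 0 F = 0 ∧ homPart 1 F = 0 ∧ homPart 2 F = p := by
  rw [le_order_iff_homPart]
  constructor
  · intro h
    have h0 := h 0 (by norm_num)
    have h1 := h 1 (by norm_num)
    have h2 := h 2 (by norm_num)
    rw [homPart_sub, homPart_coe hp] at h0 h1 h2
    refine ⟨by simpa using h0, by simpa using h1, ?_⟩
    simpa [sub_eq_zero] using h2
  · rintro ⟨h0, h1, h2⟩ k hk
    rw [homPart_sub, homPart_coe hp]
    interval_cases k <;> simp [h0, h1, h2]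

theorem isNearIdentity_iff (W : Series) :
    IsNearIdentity W ↔ ((3 : ℕ) : ℕ∞) ≤ (W - genIdPoly).order := by
  rw [le_order_sub_coe_iff genIdPoly_isHomogeneous, coe_genIdPoly, IsNearIdentity]

theorem isOscPlusHigher_iff (G : Series) :
    IsOscPlusHigher G ↔ ((3 : ℕ) : ℕ∞) ≤ (G - osc).order := by
  rw [le_order_sub_coe_iff osc_isHomogeneous, IsOscPlusHigher]

/-- The power series `½ (|∂w/∂q|² - |∂w/∂η|²)`. -/
def gradSeries (w : Series) : Series :=
  MvPowerSeries.C (1 / 2) * ∑ j : Fin 2, (MvPowerSeries.pderiv ℝ (Sum.inl j) w ^ 2 -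
    MvPowerSeries.pderiv ℝ (Sum.inr j) w ^ 2)

theorem gradSeries_coe (p : MvPolynomial Idx ℝ) : gradSeries (p : Series) = (gradForm p : Series) := by
  simp only [gradSeries, gradForm, Fin.sum_univ_two, MvPolynomial.coe_add, coe_sub,
    MvPolynomial.coe_mul, MvPolynomial.coe_C, MvPowerSeries.pderiv_coe, MvPolynomial.coe_pow]

theorem le_order_C_mul {n : ℕ} {F : Series} (c : ℝ) (h : (n : ℕ∞) ≤ F.order) :
    (n : ℕ∞) ≤ (MvPowerSeries.C c * F).order := by
  rw [← MvPowerSeries.smul_eq_C_mul]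
  exact h.trans MvPowerSeries.le_order_smul

theorem le_order_gradSeries {n : ℕ} {w : Series} (h : ((n + 1 : ℕ) : ℕ∞) ≤ w.order) :
    ((n + n : ℕ) : ℕ∞) ≤ (gradSeries w).order := by
  refine le_order_C_mul _ (le_order_sum _ fun j _ => ?_)
  rw [sq, sq]
  exact le_order_sub (le_order_mul_of_le (le_order_pderiv _ h) (le_order_pderiv _ h))
    (le_order_mul_of_le (le_order_pderiv _ h) (le_order_pderiv _ h))

theorem le_order_gradSeries_add_sub {n m : ℕ} {u v : Series} (hu : ((n + 1 : ℕ) : ℕ∞) ≤ u.order)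
    (hv : ((m + 1 : ℕ) : ℕ∞) ≤ v.order) (hnm : n ≤ m) :
    ((n + m : ℕ) : ℕ∞) ≤ (gradSeries (u + v) - gradSeries u).order := by
  rw [gradSeries, gradSeries, ← mul_sub, ← Finset.sum_sub_distrib]
  refine le_order_C_mul _ (le_order_sum _ fun j _ => ?_)
  have h : ∀ k, ((n + m : ℕ) : ℕ∞) ≤ ((MvPowerSeries.pderiv ℝ k u + MvPowerSeries.pderiv ℝ k u +
      MvPowerSeries.pderiv ℝ k v) * MvPowerSeries.pderiv ℝ k v).order := by
    intro k
    have hu' := le_order_pderiv k hu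
    have hv' := le_order_pderiv k hv
    exact le_order_mul_of_le (le_order_add (le_order_add hu' hu') (le_order_of_le hv' hnm)) hv'
  convert le_order_sub (h (Sum.inl j)) (h (Sum.inr j)) using 2
  simp only [map_add]
  ring

/-- The substitution `ξ = q + ∂w/∂η`. -/
def genSubst (w : Series) : Idx → Series :=
  Sum.elim (fun j => MvPowerSeries.X (Sum.inl j) + MvPowerSeries.pderiv ℝ (Sum.inr j) w)
    fun j => MvPowerSeries.X (Sum.inr j)

theorem genSubst_near_identity {w : Series} (hw : ((3 : ℕ) : ℕ∞) ≤ w.order) (i : Idx) :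
    ((2 : ℕ) : ℕ∞) ≤ (genSubst w i - MvPowerSeries.X i).order := by
  rcases i with j | j
  · simp only [genSubst, Sum.elim_inl, add_sub_cancel_left]
    exact le_order_pderiv _ hw
  · simp [genSubst]

theorem pderiv_inr_genIdPoly (j : Fin 2) :
    MvPowerSeries.pderiv ℝ (Sum.inr j) (genIdPoly : Series) = MvPowerSeries.X (Sum.inl j) := by
  rw [MvPowerSeries.pderiv_coe, ← MvPolynomial.coe_X]
  congr 1
  fin_cases j <;> simp [genIdPoly, Fin.sum_univ_two, MvPolynomial.pderiv_X]

theorem pderiv_inl_genIdPoly (j : Fin 2) :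
    MvPowerSeries.pderiv ℝ (Sum.inl j) (genIdPoly : Series) = MvPowerSeries.X (Sum.inr j) := by
  rw [MvPowerSeries.pderiv_coe, ← MvPolynomial.coe_X]
  congr 1
  fin_cases j <;> simp [genIdPoly, Fin.sum_univ_two, MvPolynomial.pderiv_X]

theorem subst_osc (a : Idx → Series) :
    MvPowerSeries.subst a (osc : Series) =
      MvPowerSeries.C (1 / 2) * ∑ j : Fin 2, (a (Sum.inr j) ^ 2 + a (Sum.inl j) ^ 2) := by
  rw [MvPowerSeries.subst_coe, osc, map_mul, map_sum]
  simp only [map_add, map_pow, MvPolynomial.aeval_X, MvPolynomial.aeval_C]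
  rfl

/-- V depends on q alone and is untouched by the substitution. The oscillators on the two sides
become ½ ∑ ((ηⱼ + ∂w/∂qⱼ)² + qⱼ²) and ½ ∑ (ηⱼ² + (qⱼ + ∂w/∂ηⱼ)²); their difference consists of -D w,
linear in w, and the quadratic gradient term. -/
theorem transforms_iff {w : Series} (hw : ((3 : ℕ) : ℕ∞) ≤ w.order) (V : MvPolynomial (Fin 2) ℝ)
    (G : Series) :
    Transforms (genIdPoly + w) (pho V : Series) (osc + G) ↔
      MvPowerSeries.subst (genSubst w) G =
        (MvPolynomial.rename Sum.inl V : MvPolynomial Idx ℝ) + gradSeries w - oscD w := by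
  have ha : (Sum.elim (fun j => MvPowerSeries.pderiv ℝ (Sum.inr j) (genIdPoly + w))
        (fun j => MvPowerSeries.X (Sum.inr j)) : Idx → Series) = genSubst w := by
    funext i
    rcases i with j | j
    · simp only [Sum.elim_inl, genSubst, map_add, pderiv_inr_genIdPoly]
    · rfl
  set b : Idx → Series := Sum.elim (fun j => MvPowerSeries.X (Sum.inl j))
    (fun j => MvPowerSeries.pderiv ℝ (Sum.inl j) (genIdPoly + w)) with hb
  have hbX : ∀ i, ((2 : ℕ) : ℕ∞) ≤ (b i - MvPowerSeries.X i).order := by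
    intro i
    rcases i with j | j
    · simp [hb]
    · simp only [hb, Sum.elim_inr, map_add, pderiv_inl_genIdPoly, add_sub_cancel_left]
      exact le_order_pderiv _ hw
  have hV : MvPowerSeries.subst b ((MvPolynomial.rename Sum.inl V : MvPolynomial Idx ℝ) : Series) =
      (MvPolynomial.rename Sum.inl V : MvPolynomial Idx ℝ) := by
    rw [MvPowerSeries.subst_coe, MvPolynomial.aeval_rename]
    have h1 := MvPowerSeries.subst_coe (a := (MvPowerSeries.X : Idx → Series))
      (MvPolynomial.rename Sum.inl V : MvPolynomial Idx ℝ)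
    rw [MvPowerSeries.subst_self, id, MvPolynomial.aeval_rename] at h1
    rw [h1]
    rfl
  rw [Transforms, ha, pho, MvPolynomial.coe_add, MvPowerSeries.subst_add
    (hasSubst_of_near_identity (genSubst_near_identity hw)), MvPowerSeries.subst_add
    (hasSubst_of_near_identity hbX), hV, subst_osc, subst_osc]
  have h2 : MvPowerSeries.C (1 / 2 : ℝ) * 2 = (1 : Series) := by
    rw [show (2 : Series) = MvPowerSeries.C 2 from (map_ofNat MvPowerSeries.C 2).symm, ← map_mul]
    norm_num
  have key : MvPowerSeries.C (1 / 2) * ∑ j : Fin 2, (b (Sum.inr j) ^ 2 + b (Sum.inl j) ^ 2) -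
      MvPowerSeries.C (1 / 2) * ∑ j : Fin 2, (genSubst w (Sum.inr j) ^ 2 +
        genSubst w (Sum.inl j) ^ 2) = gradSeries w - oscD w := by
    simp only [hb, genSubst, gradSeries, oscD, Sum.elim_inl, Sum.elim_inr, map_add,
      pderiv_inl_genIdPoly, Fin.sum_univ_two]
    linear_combination
      (MvPowerSeries.X (Sum.inr 0) * MvPowerSeries.pderiv ℝ (Sum.inl 0) w +
        MvPowerSeries.X (Sum.inr 1) * MvPowerSeries.pderiv ℝ (Sum.inl 1) w -
        MvPowerSeries.X (Sum.inl 0) * MvPowerSeries.pderiv ℝ (Sum.inr 0) w -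
        MvPowerSeries.X (Sum.inl 1) * MvPowerSeries.pderiv ℝ (Sum.inr 1) w) * h2
  constructor
  · intro h
    linear_combination h + key
  · intro h
    linear_combination h - key

theorem homPart_subst_genSubst {w F : Series} (hw : ((3 : ℕ) : ℕ∞) ≤ w.order) {n k : ℕ}
    (hF : (n : ℕ∞) ≤ F.order) (hk : k ≤ n) :
    homPart k (MvPowerSeries.subst (genSubst w) F) = homPart k F := by
  have := homPart_eq_zero_of_le_order
    (le_order_subst_sub_self (genSubst_near_identity hw) hF) (Nat.lt_succ_of_le hk)
  rwa [homPart_sub, sub_eq_zero] at this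

/-- Parts of the kernel and of the image of `D` that cancel vanish. -/
theorem eq_zero_of_ker_add_oscD_eq_zero {k : ℕ} {F G : Series} (hG : oscD (homPart k G) = 0)
    (hF : ∃ P : MvPolynomial Idx ℝ, P.IsHomogeneous k ∧ oscD (P : Series) = homPart k F)
    (h : homPart k G + oscD (homPart k F) = 0) : homPart k G = 0 ∧ homPart k F = 0 := by
  obtain ⟨P, hP, e⟩ := hF
  obtain ⟨g, hg, eg⟩ := exists_coe_eq_homPart k G
  rw [← eg, ← e, oscD_coe, oscD_coe] at h
  rw [← eg] at hG
  rw [← eg, ← e, oscD_coe]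
  rw [← MvPolynomial.coe_add, ← MvPolynomial.coe_zero, MvPolynomial.coe_inj] at h
  rw [oscD_coe, ← MvPolynomial.coe_zero, MvPolynomial.coe_inj] at hG
  have hDP := oscPolyD_isHomogeneous hP
  have h1 : oscPolyD (oscPolyD (oscPolyD P)) = 0 := by
    have := congrArg oscPolyD h
    rwa [map_add, hG, zero_add, map_zero] at this
  have h2 := oscPolyD_eq_zero_of_oscPolyD_oscPolyD hDP h1
  have h3 := oscPolyD_eq_zero_of_oscPolyD_oscPolyD hP h2
  rw [h3, map_zero, add_zero] at h
  simp [h, h3]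

theorem le_order_succ {n : ℕ} {F : Series} (h : (n : ℕ∞) ≤ F.order) (hn : homPart n F = 0) :
    ((n + 1 : ℕ) : ℕ∞) ≤ F.order := by
  rw [le_order_iff_homPart] at *
  intro k hk
  rcases (Nat.lt_succ_iff.mp hk).lt_or_eq with hk | rfl
  · exact h k hk
  · exact hn

/-- The lowest part of a series passes unchanged through the substitution, which therefore cannot
raise the order. -/
theorem le_order_of_le_order_subst {w F : Series} (hw : ((3 : ℕ) : ℕ∞) ≤ w.order) {n : ℕ}
    (h : (n : ℕ∞) ≤ (MvPowerSeries.subst (genSubst w) F).order) : (n : ℕ∞) ≤ F.order := by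
  induction n with
  | zero => simp
  | succ n ih =>
    have hF := ih (le_order_of_le h n.le_succ)
    refine le_order_succ hF ?_
    rw [← homPart_subst_genSubst hw hF le_rfl]
    exact homPart_eq_zero_of_le_order h n.lt_succ_self

theorem isBGNF_pho_iff {ρ : ℕ} {Q : MvPolynomial (Fin 2) ℝ} {G : Series} :
    IsBGNF ρ (pho Q : Series) G ↔ ∃ H w : Series, G = osc + H ∧ ((3 : ℕ) : ℕ∞) ≤ H.order ∧
      ((3 : ℕ) : ℕ∞) ≤ w.order ∧ (∀ k, 3 ≤ k → k ≤ ρ → oscD (homPart k H) = 0) ∧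
      (∀ k, 3 ≤ k → k ≤ ρ →
        ∃ P : MvPolynomial Idx ℝ, P.IsHomogeneous k ∧ oscD (P : Series) = homPart k w) ∧
      MvPowerSeries.subst (genSubst w) H =
        (MvPolynomial.rename Sum.inl Q : MvPolynomial Idx ℝ) + gradSeries w - oscD w := by
  have hpart : ∀ {p : MvPolynomial Idx ℝ}, p.IsHomogeneous 2 → ∀ (F : Series) (k : ℕ), 3 ≤ k →
      homPart k (p + F : Series) = homPart k F := by
    intro p hp F k hk
    rw [homPart_add, homPart_coe hp, if_neg (by omega), zero_add]
  constructor
  · rintro ⟨hG, hker, W, hW, him, hT⟩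
    rw [isOscPlusHigher_iff] at hG
    rw [isNearIdentity_iff] at hW
    have eG : G = osc + (G - osc) := by ring
    have eW : W = genIdPoly + (W - genIdPoly) := by ring
    refine ⟨G - osc, W - genIdPoly, eG, hG, hW, fun k hk hkρ => ?_, fun k hk hkρ => ?_, ?_⟩
    · rw [← hpart osc_isHomogeneous _ k hk, ← eG]
      exact hker k hk hkρ
    · rw [← hpart genIdPoly_isHomogeneous _ k hk, ← eW]
      exact him k hk hkρ
    · rw [eW, eG] at hT
      rw [← transforms_iff hW]
      exact hT
  · rintro ⟨H, w, rfl, hH, hw, hker, him, hT⟩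
    refine ⟨?_, fun k hk hkρ => ?_, genIdPoly + w, ?_, fun k hk hkρ => ?_, ?_⟩
    · rwa [isOscPlusHigher_iff, add_sub_cancel_left]
    · rw [hpart osc_isHomogeneous _ k hk]
      exact hker k hk hkρ
    · rwa [isNearIdentity_iff, add_sub_cancel_left]
    · rw [hpart genIdPoly_isHomogeneous _ k hk]
      exact him k hk hkρ
    · rwa [transforms_iff hw]

/-! ### Homogeneous parts of the normal form -/

section NormalFormCoefficients

variable {ρ m : ℕ} {Q : MvPolynomial (Fin 2) ℝ} {w H : Series}

theorem rename_inl_isHomogeneous (hQ : Q.IsHomogeneous m) :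
    (MvPolynomial.rename Sum.inl Q : MvPolynomial Idx ℝ).IsHomogeneous m :=
  hQ.rename_isHomogeneous

/-- The homogeneous parts of the homological equation. -/
theorem homPart_homological (hw : ((3 : ℕ) : ℕ∞) ≤ w.order)
    (h : MvPowerSeries.subst (genSubst w) H =
      (MvPolynomial.rename Sum.inl Q : MvPolynomial Idx ℝ) + gradSeries w - oscD w) {k : ℕ}
    (hk : (k : ℕ∞) ≤ H.order) :
    homPart k H = homPart k ((MvPolynomial.rename Sum.inl Q : MvPolynomial Idx ℝ) : Series) +
      homPart k (gradSeries w) - oscD (homPart k w) := by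
  rw [← homPart_subst_genSubst hw hk le_rfl, h, homPart_sub, homPart_add, homPart_oscD]

/-- The normal form and the generating function vanish below the degree of the potential. -/
theorem le_order_of_homological (hQ : Q.IsHomogeneous m)
    (hw : ((3 : ℕ) : ℕ∞) ≤ w.order) (hH : ((3 : ℕ) : ℕ∞) ≤ H.order)
    (hker : ∀ k, 3 ≤ k → k ≤ ρ → oscD (homPart k H) = 0)
    (him : ∀ k, 3 ≤ k → k ≤ ρ →
      ∃ P : MvPolynomial Idx ℝ, P.IsHomogeneous k ∧ oscD (P : Series) = homPart k w)
    (h : MvPowerSeries.subst (genSubst w) H =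
      (MvPolynomial.rename Sum.inl Q : MvPolynomial Idx ℝ) + gradSeries w - oscD w)
    (n : ℕ) (hn : 3 ≤ n) (hnm : n ≤ m) (hnρ : n ≤ ρ + 1) :
    (n : ℕ∞) ≤ w.order ∧ (n : ℕ∞) ≤ H.order := by
  induction n, hn using Nat.le_induction with
  | base => exact ⟨hw, hH⟩
  | succ n hn ih =>
    obtain ⟨hwn, hHn⟩ := ih (by omega) (by omega)
    have e := homPart_homological hw h hHn
    rw [homPart_coe (rename_inl_isHomogeneous hQ), if_neg (by omega)] at e
    obtain ⟨l, rfl⟩ : ∃ l, n = l + 1 := ⟨n - 1, by omega⟩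
    rw [homPart_eq_zero_of_le_order (le_order_gradSeries hwn) (by omega), add_zero, zero_sub,
      eq_neg_iff_add_eq_zero] at e
    have := eq_zero_of_ker_add_oscD_eq_zero (hker _ hn (by omega)) (him _ hn (by omega)) e
    exact ⟨le_order_succ hwn this.2, le_order_succ hHn this.1⟩

/-- The leading part of the normal form. -/
theorem homPart_eq_of_homological (hQ : Q.IsHomogeneous m) (hm : 3 ≤ m) (hmρ : m ≤ ρ)
    (hw : ((3 : ℕ) : ℕ∞) ≤ w.order) (hH : ((3 : ℕ) : ℕ∞) ≤ H.order)
    (hker : ∀ k, 3 ≤ k → k ≤ ρ → oscD (homPart k H) = 0)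
    (him : ∀ k, 3 ≤ k → k ≤ ρ →
      ∃ P : MvPolynomial Idx ℝ, P.IsHomogeneous k ∧ oscD (P : Series) = homPart k w)
    (h : MvPowerSeries.subst (genSubst w) H =
      (MvPolynomial.rename Sum.inl Q : MvPolynomial Idx ℝ) + gradSeries w - oscD w) :
    homPart m H = (MvPolynomial.rename Sum.inl Q : MvPolynomial Idx ℝ) - oscD (homPart m w) := by
  obtain ⟨hwm, hHm⟩ := le_order_of_homological hQ hw hH hker him h m hm le_rfl (by omega)
  rw [homPart_homological hw h hHm, homPart_coe_self (rename_inl_isHomogeneous hQ)]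
  obtain ⟨l, rfl⟩ : ∃ l, m = l + 1 := ⟨m - 1, by omega⟩
  rw [homPart_eq_zero_of_le_order (le_order_gradSeries hwm) (by omega), add_zero]

/-- The second-order part of the normal form for a potential of odd degree. -/
theorem exists_homPart_eq_gradForm {N : ℕ} (hN : Even N) (hN0 : N ≠ 0)
    (hQ : Q.IsHomogeneous (N + 1))
    (hw : ((3 : ℕ) : ℕ∞) ≤ w.order) (hH : ((3 : ℕ) : ℕ∞) ≤ H.order)
    (hker : ∀ k, 3 ≤ k → k ≤ N + N → oscD (homPart k H) = 0)
    (him : ∀ k, 3 ≤ k → k ≤ N + N →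
      ∃ P : MvPolynomial Idx ℝ, P.IsHomogeneous k ∧ oscD (P : Series) = homPart k w)
    (h : MvPowerSeries.subst (genSubst w) H =
      (MvPolynomial.rename Sum.inl Q : MvPolynomial Idx ℝ) + gradSeries w - oscD w) :
    ∃ u : MvPolynomial Idx ℝ, u.IsHomogeneous (N + 1) ∧ oscPolyD u = MvPolynomial.rename Sum.inl Q ∧
      homPart (N + N) H = (gradForm u : Series) - oscD (homPart (N + N) w) := by
  have hN2 : 2 ≤ N := by
    obtain ⟨r, rfl⟩ := hN
    omega
  obtain ⟨hwm, hHm⟩ := le_order_of_homological hQ hw hH hker him h (N + 1) (by omega) le_rfl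
    (by omega)
  have e := homPart_eq_of_homological hQ (by omega) (by omega) hw hH hker him h
  obtain ⟨u, hu, eu⟩ := exists_coe_eq_homPart (N + 1) w
  obtain ⟨g, hg, eg⟩ := exists_coe_eq_homPart (N + 1) H
  -- N + 1 is odd, so a normal form has no part of this degree and V is absorbed entirely by D u.
  have hg0 : g = 0 := by
    refine eq_zero_of_oscPolyD_eq_zero_of_odd hN.add_one hg ?_
    have := hker (N + 1) (by omega) (by omega)
    rwa [← eg, oscD_coe, ← MvPolynomial.coe_zero, MvPolynomial.coe_inj] at this
  rw [← eg, hg0, ← eu, oscD_coe, ← coe_sub, MvPolynomial.coe_inj, eq_comm, sub_eq_zero] at e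
  have hgrad : ((N + N : ℕ) : ℕ∞) ≤ (gradSeries w).order := le_order_gradSeries hwm
  -- Strictly between N + 1 and 2N neither V nor the gradient term contributes, so H has no part
  -- there and the substitution acts trivially up to degree 2N.
  have hHN : ∀ n, N + 2 ≤ n → n ≤ N + N → (n : ℕ∞) ≤ H.order := by
    intro n hn
    induction n, hn using Nat.le_induction with
    | base =>
      intro _
      exact le_order_succ hHm (by rw [← eg, hg0, MvPolynomial.coe_zero])
    | succ n hn ih =>
      intro hnN
      have hHn := ih (by omega)
      refine le_order_succ hHn ?_
      have e' := homPart_homological hw h hHn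
      rw [homPart_coe (rename_inl_isHomogeneous hQ), if_neg (by omega),
        homPart_eq_zero_of_le_order hgrad (by omega), add_zero, zero_sub,
        eq_neg_iff_add_eq_zero] at e'
      exact (eq_zero_of_ker_add_oscD_eq_zero (hker _ (by omega) (by omega))
        (him _ (by omega) (by omega)) e').1
  refine ⟨u, hu, e.symm, ?_⟩
  rw [homPart_homological hw h (hHN (N + N) (by omega) le_rfl),
    homPart_coe (rename_inl_isHomogeneous hQ), if_neg (by omega), zero_add]
  congr 1
  -- Only the leading part u of w reaches degree 2N in the gradient term: the cross terms with the
  -- remainder have order at least N + (N + 1).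
  have hv : ((N + 1 + 1 : ℕ) : ℕ∞) ≤ (w - u).order := by
    refine le_order_succ (le_order_sub hwm (le_order_coe hu)) ?_
    rw [homPart_sub, homPart_coe_self hu, eu, sub_self]
  have h1 := homPart_eq_zero_of_le_order
    (le_order_gradSeries_add_sub (le_order_coe hu) hv N.le_succ) (k := N + N) (by omega)
  rw [add_sub_cancel, homPart_sub, sub_eq_zero, gradSeries_coe,
    homPart_coe_self (gradForm_isHomogeneous hu)] at h1
  exact h1

/-- A generating function that normalizes `pho Q` up to degree `ρ` extends to all degrees. -/
theorem exists_isBGNF {g : MvPolynomial Idx ℝ} (hρ : 3 ≤ ρ) (hg : g.IsHomogeneous ρ)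
    (hg0 : oscPolyD g = 0)
    (hw : ((3 : ℕ) : ℕ∞) ≤ w.order)
    (him : ∀ k, 3 ≤ k → k ≤ ρ →
      ∃ P : MvPolynomial Idx ℝ, P.IsHomogeneous k ∧ oscD (P : Series) = homPart k w)
    (h : ((ρ + 1 : ℕ) : ℕ∞) ≤ ((MvPolynomial.rename Sum.inl Q : MvPolynomial Idx ℝ) +
      gradSeries w - oscD w - g).order) :
    ∃ G, IsBGNF ρ (pho Q : Series) G ∧ ∀ k ≤ ρ, homPart k G = homPart k (osc + g : Series) := by
  -- The generating function is prescribed, and the normal form is obtained by inverting the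
  -- substitution ξ = q + ∂w/∂η.
  obtain ⟨H, hH⟩ := exists_subst_eq (genSubst_near_identity hw)
    ((MvPolynomial.rename Sum.inl Q : MvPolynomial Idx ℝ) + gradSeries w - oscD w)
  have hHρ : (ρ : ℕ∞) ≤ H.order := by
    refine le_order_of_le_order_subst hw ?_
    rw [hH]
    have := le_order_add (le_order_of_le h ρ.le_succ) (le_order_coe hg)
    rwa [sub_add_cancel] at this
  have hpart : ∀ k ≤ ρ, homPart k H = homPart k (g : Series) := by
    intro k hk
    rw [← homPart_subst_genSubst hw hHρ hk, hH, ← sub_eq_zero, ← homPart_sub]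
    exact homPart_eq_zero_of_le_order h (Nat.lt_succ_of_le hk)
  refine ⟨osc + H, isBGNF_pho_iff.mpr ⟨H, w, rfl, le_order_of_le hHρ hρ, hw, ?_, him, hH⟩, ?_⟩
  · intro k _ hk
    rw [hpart k hk, ← homPart_oscD, oscD_coe, hg0, MvPolynomial.coe_zero]
    ext d
    simp [coeff_homPart]
  · intro k hk
    rw [homPart_add, homPart_add, hpart k hk]

end NormalFormCoefficients

/-- Comparing the two normal forms in degree 2N gives one direction. For the other, generating
functions for V and U are built so that both normal forms start with osc plus the same kernel
element g, and are then completed to power series. -/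
theorem sharesBGNF_iff {N : ℕ} (hN : Even N) (hN0 : N ≠ 0) {V U : MvPolynomial (Fin 2) ℝ}
    (hV : V.IsHomogeneous (N + 1)) (hU : U.IsHomogeneous (N + N)) :
    SharesBGNF (N + N) (pho V : Series) (pho U : Series) ↔ HomologicalMatch N V U := by
  have hN2 : 2 ≤ N := by
    obtain ⟨r, rfl⟩ := hN
    omega
  constructor
  · rintro ⟨G, G', hG, hG', hGG⟩
    obtain ⟨H, w, rfl, hH, hw, hker, him, h⟩ := isBGNF_pho_iff.mp hG
    obtain ⟨H', w', rfl, hH', hw', hker', him', h'⟩ := isBGNF_pho_iff.mp hG'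
    obtain ⟨u, hu, huV, e⟩ := exists_homPart_eq_gradForm hN hN0 hV hw hH hker him h
    have e' := homPart_eq_of_homological hU (by omega) le_rfl hw' hH' hker' him' h'
    have hHH := hGG (N + N) le_rfl
    rw [homPart_add, homPart_add, add_right_inj, e, e'] at hHH
    obtain ⟨r, hr, er⟩ := exists_coe_eq_homPart (N + N) w
    obtain ⟨r', hr', er'⟩ := exists_coe_eq_homPart (N + N) w'
    refine ⟨u, r - r', hu, hr.sub hr', huV, ?_⟩
    rw [← MvPolynomial.coe_inj (σ := Idx), coe_sub, map_sub, coe_sub, ← oscD_coe, ← oscD_coe, er,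
      er']
    linear_combination -hHH
  · rintro ⟨u, r, hu, hr, huV, hrU⟩
    -- All parts of the generating functions must lie in the image of D. So u = D u', and both U and
    -- `gradForm u` are brought to the form g + D (D ·) with common g; D s and D (r' + s) are the
    -- degree-2N parts.
    obtain ⟨u', hu', rfl⟩ := exists_oscPolyD_eq_of_odd hN.add_one hu
    obtain ⟨g, s, hg, hs, hg0, eg⟩ := exists_ker_add_oscPolyD_oscPolyD
      (rename_inl_isHomogeneous hU)
    obtain ⟨r0, r', hr0, hr', hr00, er⟩ := exists_ker_add_oscPolyD hr
    have hr1 := oscPolyD_isHomogeneous (hr'.add hs)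
    have hs1 := oscPolyD_isHomogeneous hs
    have hgrad : gradForm (oscPolyD u') = g + oscPolyD (oscPolyD (r' + s)) := by
      have e1 : oscPolyD r = oscPolyD (oscPolyD r') := by rw [er, map_add, hr00, zero_add]
      rw [eq_comm, sub_eq_iff_eq_add] at hrU
      rw [hrU, e1, eg, map_add, map_add]
      ring
    obtain ⟨G, hG, hGg⟩ := exists_isBGNF (Q := V) (w := oscPolyD u' + oscPolyD (r' + s))
      (by omega) hg hg0
      (le_order_add (le_order_of_le (le_order_coe hu) (by omega))
        (le_order_of_le (le_order_coe hr1) (by omega)))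
      (by
        intro k _ _
        rw [homPart_add, homPart_coe hu, homPart_coe hr1]
        by_cases hk1 : k = N + 1
        · rw [if_pos hk1, if_neg (by omega), add_zero]
          exact ⟨u', hk1 ▸ hu', oscD_coe _⟩
        · rw [if_neg hk1, zero_add]
          split_ifs with hk2
          · exact ⟨r' + s, hk2 ▸ hr'.add hs, oscD_coe _⟩
          · exact ⟨0, MvPolynomial.isHomogeneous_zero _ _ _, by rw [oscD_coe]; simp⟩)
      (by
        -- The error is the change of the gradient term caused by the degree-2N part, of order at
        -- least N + (2N - 1), which exceeds 2N because N ≥ 2.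
        obtain ⟨l, hl⟩ : ∃ l, N + N = l + 1 := ⟨N + N - 1, by omega⟩
        have := le_order_gradSeries_add_sub (le_order_coe hu)
          (m := l) (v := (oscPolyD (r' + s) : Series)) (by rw [← hl]; exact le_order_coe hr1)
          (by omega)
        refine le_order_of_le (n := N + l) ?_ (by omega)
        refine (congrArg (MvPowerSeries.order (σ := Idx) (R := ℝ)) ?_).trans_ge this
        rw [oscD_add, oscD_coe, oscD_coe, huV, gradSeries_coe (oscPolyD u'), hgrad,
          MvPolynomial.coe_add]
        ring)
    obtain ⟨G', hG', hGg'⟩ := exists_isBGNF (Q := U) (w := oscPolyD s) (by omega) hg hg0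
      (le_order_of_le (le_order_coe hs1) (by omega))
      (by
        intro k _ _
        rw [homPart_coe hs1]
        split_ifs with hk2
        · exact ⟨s, hk2 ▸ hs, oscD_coe _⟩
        · exact ⟨0, MvPolynomial.isHomogeneous_zero _ _ _, by rw [oscD_coe]; simp⟩)
      (by
        have := le_order_coe (gradForm_isHomogeneous (n := N + N - 1) (w := oscPolyD s) (by
          rwa [Nat.sub_add_cancel (by omega)]))
        refine le_order_of_le (n := N + N - 1 + (N + N - 1)) ?_ (by omega)
        refine (congrArg (MvPowerSeries.order (σ := Idx) (R := ℝ)) ?_).trans_ge this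
        rw [gradSeries_coe, oscD_coe, eg, MvPolynomial.coe_add]
        ring)
    exact ⟨G, G', hG, hG', fun k hk => by rw [hGg k hk, hGg' k hk]⟩

end PHO

end

/-! ### Hamilton-Jacobi separability as splitting of the potential -/

noncomputable section

namespace PHO

open MeasureTheory

/-! ### Separability of the Hamilton-Jacobi equation -/

/-- The integral is the value at 0 of the convolution of the indicator of (0, 1] with t ↦ h(p, -t),
so smoothness in p follows from that of convolutions with parameters. The cutoff χ supplies the
compact support required there and equals 1 on the range of integration. -/
theorem contDiffOn_intervalIntegral_param {P : Type*} [NormedAddCommGroup P] [NormedSpace ℝ P]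
    {n : ℕ∞} {s : Set P} (hs : IsOpen s) {h : P → ℝ → ℝ}
    (hh : ContDiffOn ℝ n (fun z : P × ℝ => h z.1 z.2) (s ×ˢ Set.univ)) :
    ContDiffOn ℝ n (fun p => ∫ t in (0 : ℝ)..1, h p t) s := by
  let χ : ContDiffBump (0 : ℝ) := ⟨1, 2, one_pos, one_lt_two⟩
  have hχ : ∀ t, t ∈ Set.Icc (-1 : ℝ) 0 → χ t = 1 := fun t ht => by
    apply χ.one_of_mem_closedBall
    rw [Metric.mem_closedBall, Real.dist_eq, sub_zero, abs_le]
    exact ⟨ht.1, ht.2.trans zero_le_one⟩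
  have hχ0 : ∀ t, t ∉ Metric.closedBall (0 : ℝ) 2 → χ t = 0 := fun t ht =>
    χ.zero_of_le_dist (not_le.mp ht).le
  have key := contDiffOn_convolution_right_with_param_comp (μ := volume)
    (ContinuousLinearMap.mul ℝ ℝ) (n := n) (s := s) (v := fun _ => (0 : ℝ)) contDiffOn_const
    (f := (Set.Ioc (0 : ℝ) 1).indicator 1) (g := fun p t => χ t * h p (-t))
    hs (isCompact_closedBall (0 : ℝ) 2) (fun p t _ ht => by rw [hχ0 t ht, zero_mul])
    (((integrable_indicator_iff measurableSet_Ioc).mpr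
      (integrableOn_const (by simp) (by simp))).locallyIntegrable)
    ((χ.contDiff.comp contDiff_snd).contDiffOn.mul
      (hh.comp (contDiff_fst.prodMk contDiff_snd.neg).contDiffOn
        fun z hz => ⟨hz.1, Set.mem_univ _⟩))
  refine key.congr fun p _ => ?_
  rw [convolution_def, intervalIntegral.integral_of_le zero_le_one,
    ← integral_indicator measurableSet_Ioc]
  congr 1
  ext t
  by_cases ht : t ∈ Set.Ioc (0 : ℝ) 1
  · have : χ (0 - t) = 1 := hχ _ ⟨by linarith [ht.2], by linarith [ht.1]⟩
    rw [zero_sub] at this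
    simp [ht, this]
  · simp [ht]

/-- The action integrals `∫ √(2 (b - u))`, for energies `b` above the values of `u`. -/
theorem exists_contDiffOn_action {u : ℝ → ℝ} (hu : ContDiff ℝ 2 u) (x₀ : ℝ) :
    ∃ (c : ℝ) (T : ℝ → ℝ → ℝ),
      ContDiffOn ℝ 2 (fun z : ℝ × ℝ => T z.1 z.2) (Metric.ball x₀ 1 ×ˢ Set.Ioi c) ∧
      (∀ x b, HasDerivAt (fun x => T x b) (√(2 * (b - u x))) x) ∧
      ∀ x ∈ Metric.ball x₀ 1, u x ≤ c := by
  -- The bound is taken on twice the radius to leave room for the cutoff t χ(t), which is bounded by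
  -- 2.
  obtain ⟨c, hc⟩ := (isCompact_closedBall x₀ 2).bddAbove_image hu.continuous.continuousOn
  replace hc : ∀ x, |x - x₀| ≤ 2 → u x ≤ c := fun x hx => hc ⟨x, hx, rfl⟩
  refine ⟨c, fun x b => ∫ t in x₀..x, √(2 * (b - u t)), ?_, ?_, ?_⟩
  · let χ : ContDiffBump (0 : ℝ) := ⟨1, 2, one_pos, one_lt_two⟩
    have hχ : ∀ t, |t * χ t| ≤ 2 := fun t => by
      by_cases ht : 2 ≤ |t|
      · rw [χ.zero_of_le_dist (by rwa [Real.dist_eq, sub_zero])]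
        simp
      · rw [abs_mul, abs_of_nonneg χ.nonneg]
        nlinarith [χ.nonneg (x := t), χ.le_one (x := t), abs_nonneg t]
    -- Rescaling to t in [0, 1] makes the limits constant. Writing t χ(t) for t leaves [0, 1]
    -- unchanged and keeps the argument of u in the ball for all real t, where the radicand is
    -- positive.
    have h : ContDiffOn ℝ 2
        (fun z : (ℝ × ℝ) × ℝ => √(2 * (z.1.2 - u (x₀ + z.2 * χ z.2 * (z.1.1 - x₀)))))
        ((Metric.ball x₀ 1 ×ˢ Set.Ioi c) ×ˢ Set.univ) := by
      refine ContDiffOn.sqrt (ContDiff.contDiffOn ?_) ?_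
      · have := χ.contDiff (n := 2)
        fun_prop
      · rintro ⟨⟨x, b⟩, t⟩ ⟨⟨hx, hb⟩, -⟩
        have hx' : |x - x₀| < 1 := hx
        have : u (x₀ + t * χ t * (x - x₀)) ≤ c := by
          apply hc
          rw [add_sub_cancel_left, abs_mul]
          nlinarith [hχ t, abs_nonneg (t * χ t), abs_nonneg (x - x₀)]
        have hb' : c < b := hb
        exact (mul_pos two_pos (sub_pos.mpr (this.trans_lt hb'))).ne'
    have h1 := contDiffOn_intervalIntegral_param (n := 2)
      (Metric.isOpen_ball.prod isOpen_Ioi)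
      (h := fun (p : ℝ × ℝ) t => √(2 * (p.2 - u (x₀ + t * χ t * (p.1 - x₀))))) h
    refine (((contDiff_fst.sub (contDiff_const (c := x₀))).contDiffOn (s := _)).mul h1).congr ?_
    rintro ⟨x, b⟩ -
    have e : ∫ t in (0 : ℝ)..1, √(2 * (b - u (x₀ + t * χ t * (x - x₀)))) =
        ∫ t in (0 : ℝ)..1, √(2 * (b - u (x₀ + (x - x₀) * t))) := by
      refine intervalIntegral.integral_congr fun t ht => ?_
      rw [Set.uIcc_of_le zero_le_one] at ht
      have : χ t = 1 := χ.one_of_mem_closedBall (by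
        rw [Metric.mem_closedBall, Real.dist_eq, sub_zero, abs_le]
        exact ⟨by linarith [ht.1], ht.2⟩)
      simp only [this, mul_one, mul_comm]
    simp only
    rw [e, intervalIntegral.mul_integral_comp_add_mul (f := fun t => √(2 * (b - u t)))]
    simp
  · intro x b
    have : Continuous fun t => √(2 * (b - u t)) := by
      have := hu.continuous
      fun_prop
    exact intervalIntegral.integral_hasDerivAt_right (this.intervalIntegrable _ _)
      (this.stronglyMeasurableAtFilter _ _) this.continuousAt
  · intro x hx
    exact hc x ((le_of_lt hx).trans one_le_two)

/-- The parameters are the energies of the two one-dimensional motions, so the mixed matrix is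
diagonal with entries 1 / √(2 (aᵢ - uᵢ)), nonzero above the values of uᵢ. -/
theorem isHJSeparable_of_eq_sum {H : (Fin 2 → ℝ) → (Fin 2 → ℝ) → ℝ} {u : Fin 2 → ℝ → ℝ}
    (hu : ∀ i, ContDiff ℝ 2 (u i)) (hH : ∀ q p, H q p = ∑ i, (p i ^ 2 / 2 + u i (q i))) :
    IsHJSeparable H := by
  intro q₀
  choose c T hT hT' hc using fun i => exists_contDiffOn_action (hu i) (q₀ i)
  have hopen : IsOpen {a : Fin 2 → ℝ | ∀ i, c i < a i} := by
    rw [Set.ofPred_forall]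
    exact isOpen_iInter_of_finite fun i => isOpen_lt continuous_const (continuous_apply i)
  refine ⟨1, one_pos, {a | ∀ i, c i < a i}, hopen, ⟨fun i => c i + 1, fun i => lt_add_one _⟩,
    fun i x a => T i x (a i), fun a => ∑ i, a i, fun i => ?_, fun q hq a ha => ?_⟩
  · exact (hT i).comp (g := fun z : ℝ × ℝ => T i z.1 z.2)
      (f := fun z : ℝ × (Fin 2 → ℝ) => (z.1, z.2 i))
      (contDiff_fst.prodMk ((contDiff_apply ℝ ℝ i).comp contDiff_snd)).contDiffOn
      fun z hz => ⟨hz.1, hz.2 i⟩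
  · simp only [fun i x b => (hT' i x b).deriv]
    have hpos : ∀ i, 0 < a i - u i (q i) := fun i => by
      have hq' : q i ∈ Metric.ball (q₀ i) 1 := (dist_le_pi_dist q q₀ i).trans_lt hq
      have := hc i (q i) hq'
      linarith [ha i]
    constructor
    · rw [hH]
      refine Finset.sum_congr rfl fun i _ => ?_
      rw [Real.sq_sqrt (mul_pos two_pos (hpos i)).le]
      ring
    · have hd : ∀ i, HasFDerivAt (fun b : Fin 2 → ℝ => √(2 * (b i - u i (q i))))
          ((1 / (2 * √(2 * (a i - u i (q i))))) •
            ((2 : ℝ) • ContinuousLinearMap.proj (R := ℝ) (φ := fun _ : Fin 2 => ℝ) i)) a :=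
        fun i => (((hasFDerivAt_apply i a).sub_const _).const_mul 2).sqrt (mul_pos two_pos (hpos i)).ne'
      have hs : ∀ i, √(a i - u i (q i)) ≠ 0 := fun i => (Real.sqrt_pos.mpr (hpos i)).ne'
      simp only [fun i => (hd i).fderiv, Matrix.det_fin_two]
      simp [hs]

theorem IsHJSeparable.exists_eq_add {H : (Fin 2 → ℝ) → (Fin 2 → ℝ) → ℝ} {F : (Fin 2 → ℝ) → ℝ}
    (hH : ∀ q p, H q p = ∑ i, p i ^ 2 / 2 + F q) (h : IsHJSeparable H) :
    ∃ ε > 0, ∃ f : Fin 2 → ℝ → ℝ, ∀ q ∈ Metric.ball (0 : Fin 2 → ℝ) ε, F q = f 0 (q 0) + f 1 (q 1) := by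
  obtain ⟨ε, hε, A, -, ⟨a, ha⟩, S, E, -, hS⟩ := h 0
  -- A single parameter value near the origin suffices; its energy is shared equally between the two
  -- summands.
  refine ⟨ε, hε, fun i x => E a / 2 - deriv (fun x => S i x a) x ^ 2 / 2, fun q hq => ?_⟩
  have := (hS q hq a ha).1
  rw [hH, Fin.sum_univ_two] at this
  linarith

open MvPolynomial in
-- A sum of one-variable functions satisfies F(x, y) = F(x, 0) + F(0, y) - F(0, 0), whatever their
-- regularity. The sup-norm ball is a square containing these points, and a polynomial identity on
-- it holds everywhere.
theorem pderiv_pderiv_eq_zero_of_eq_add {F : MvPolynomial (Fin 2) ℝ} {ε : ℝ} (hε : 0 < ε)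
    {f : Fin 2 → ℝ → ℝ}
    (h : ∀ q ∈ Metric.ball (0 : Fin 2 → ℝ) ε, eval q F = f 0 (q 0) + f 1 (q 1)) :
    pderiv 0 (pderiv 1 F) = 0 := by
  have heval : ∀ (g : Fin 2 → MvPolynomial (Fin 2) ℝ) (q : Fin 2 → ℝ),
      eval q (aeval g F) = eval (fun i => eval q (g i)) F := fun g q => by
    rw [← coe_aeval_eq_eval, ← coe_aeval_eq_eval]
    change ((aeval q).comp (aeval g)) F = _
    rw [comp_aeval]
    rfl
  have hF : F = aeval ![X 0, 0] F + aeval ![0, X 1] F - aeval ![0, 0] F := by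
    refine MvPolynomial.funext_set (fun _ => Set.Ioo (-ε) ε)
      (fun _ => Set.Ioo_infinite (by linarith)) fun q hq => ?_
    have hmem : ∀ v : Fin 2 → ℝ, (∀ i, v i = q i ∨ v i = 0) →
        v ∈ Metric.ball (0 : Fin 2 → ℝ) ε := fun v hv => by
      rw [mem_ball_zero_iff, pi_norm_lt_iff hε]
      intro i
      rw [Real.norm_eq_abs, abs_lt]
      rcases hv i with e | e <;> rw [e]
      · exact hq i (Set.mem_univ i)
      · exact ⟨neg_lt_zero.mpr hε, hε⟩
    simp only [map_add, map_sub, heval]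
    rw [h q (hmem _ fun i => Or.inl rfl), h _ (hmem _ fun i => by fin_cases i <;> simp),
      h _ (hmem _ fun i => by fin_cases i <;> simp), h _ (hmem _ fun i => by fin_cases i <;> simp)]
    simp
    ring
  have h1 : pderiv 1 (aeval ![X 0, 0] F : MvPolynomial (Fin 2) ℝ) = 0 := by
    rw [derivation_aeval, Fin.sum_univ_two]
    simp [pderiv_X]
  have h2 : pderiv 0 (aeval ![0, X 1] F : MvPolynomial (Fin 2) ℝ) = 0 := by
    rw [derivation_aeval, Fin.sum_univ_two]
    simp [pderiv_X]
  have h3 : pderiv 1 (aeval ![0, 0] F : MvPolynomial (Fin 2) ℝ) = 0 := by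
    rw [derivation_aeval, Fin.sum_univ_two]
    simp
  rw [hF, map_sub, map_add, h1, h3, zero_add, sub_zero, pderiv_pderiv_comm, h2, map_zero]

open MvPolynomial in
theorem eval_pho_rot (ψ : ℝ) (V : MvPolynomial (Fin 2) ℝ) (q p : Fin 2 → ℝ) :
    eval (Sum.elim ((rot ψ)⁻¹ *ᵥ q) ((rot ψ)⁻¹ *ᵥ p)) (pho V) =
      ∑ i, p i ^ 2 / 2 + (∑ i, q i ^ 2 / 2 + eval q (rotPoly ψ V)) := by
  rw [pho, map_add, eval_rename, Sum.elim_comp_inl, eval_rotPoly, ← add_assoc, add_left_inj, osc,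
    rot_inv]
  simp [Fin.sum_univ_two, dotProduct]
  linear_combination (p 0 ^ 2 + p 1 ^ 2 + q 0 ^ 2 + q 1 ^ 2) / 2 * Real.sin_sq_add_cos_sq ψ

theorem isSeparableInRotated_pho_iff {n : ℕ} {V : MvPolynomial (Fin 2) ℝ}
    (hV : V.IsHomogeneous (n + 1)) (ψ : ℝ) :
    IsSeparableInRotated ψ (pho V) ↔ IsSplit ψ V := by
  constructor
  · intro h
    obtain ⟨ε, hε, f, hf⟩ := IsHJSeparable.exists_eq_add (eval_pho_rot ψ V) h
    refine pderiv_pderiv_eq_zero_of_eq_add hε (f := fun i x => f i x - x ^ 2 / 2) fun q hq => ?_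
    have := hf q hq
    rw [Fin.sum_univ_two] at this
    linarith
  · intro h
    obtain ⟨a, b, e⟩ := eq_sum_pow_of_pderiv_pderiv_eq_zero (rotPoly_isHomogeneous ψ hV) h
    refine isHJSeparable_of_eq_sum
      (u := fun i x => x ^ 2 / 2 + ![a, b] i * x ^ (n + 1)) (fun i => by fun_prop) fun q p => ?_
    rw [eval_pho_rot, e]
    simp [Fin.sum_univ_two]
    ring

end PHO

end

/-! ### Existence, necessity and uniqueness for Hamiltonians -/

noncomputable section

namespace PHO

theorem exists_sharesBGNF_pho {N : ℕ} (hN : Even N) (hN0 : N ≠ 0) {V : MvPolynomial (Fin 2) ℝ}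
    (hV : V.IsHomogeneous (N + 1)) {ψ : ℝ} (h : IsSeparableInRotated ψ (pho V)) :
    ∃ U : MvPolynomial (Fin 2) ℝ, U.IsHomogeneous (N + N) ∧
      SharesBGNF (N + N) (pho V : Series) (pho U : Series) ∧ IsSeparableInRotated ψ (pho U) ∧
      (V ≠ 0 → U ≠ 0) := by
  obtain ⟨U, hU, hVU, hs, h0⟩ := exists_polarizedMatch_of_isSplit hN hN0 hV
    ((isSeparableInRotated_pho_iff hV ψ).mp h)
  refine ⟨U, hU, ?_, ?_, h0⟩
  · rwa [sharesBGNF_iff hN hN0 hV hU, homologicalMatch_iff hN hV hU]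
  · obtain ⟨n, rfl⟩ := Nat.exists_eq_succ_of_ne_zero hN0
    exact (isSeparableInRotated_pho_iff (n := n + 1 + n) hU ψ).mpr hs

theorem exists_isSeparableInRotated_of_sharesBGNF {N : ℕ} (hN : Even N) (hN0 : N ≠ 0)
    {V U : MvPolynomial (Fin 2) ℝ} (hV : V.IsHomogeneous (N + 1)) (hU : U.IsHomogeneous (N + N))
    (h : SharesBGNF (N + N) (pho V : Series) (pho U : Series)) :
    ∃ ψ : ℝ, IsSeparableInRotated ψ (pho V) := by
  rw [sharesBGNF_iff hN hN0 hV hU, homologicalMatch_iff hN hV hU] at h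
  obtain ⟨M, rfl⟩ := Nat.exists_eq_succ_of_ne_zero hN0
  obtain ⟨ψ, hψ⟩ := PolarizedMatch.exists_isSplit (by
    rwa [Nat.succ_eq_add_one, Nat.even_add_one, Nat.not_even_iff_odd] at hN) hV h
  exact ⟨ψ, (isSeparableInRotated_pho_iff hV ψ).mpr hψ⟩

theorem SharesBGNF.unique {N : ℕ} (hN : Even N) (hN0 : N ≠ 0) {V U U' : MvPolynomial (Fin 2) ℝ}
    (hV : V.IsHomogeneous (N + 1)) (hU : U.IsHomogeneous (N + N)) (hU' : U'.IsHomogeneous (N + N))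
    (h : SharesBGNF (N + N) (pho V : Series) (pho U : Series))
    (h' : SharesBGNF (N + N) (pho V : Series) (pho U' : Series)) : U = U' := by
  rw [sharesBGNF_iff hN hN0 hV ‹_›, homologicalMatch_iff hN hV ‹_›] at h h'
  exact PolarizedMatch.unique hU hU' h h'

end PHO

end

theorem theorem1p2 (δ : ℕ) (hδ : 3 ≤ δ) (hodd : Odd δ)
    (V : MvPolynomial (Fin 2) ℝ) (hV : V.IsHomogeneous δ) :
    ((∃ U : MvPolynomial (Fin 2) ℝ, U.IsHomogeneous (2 * δ - 2) ∧
        PHO.SharesBGNF (2 * δ - 2) (PHO.pho V : PHO.Series) (PHO.pho U : PHO.Series)) ↔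
      ∃ ψ : ℝ, PHO.IsSeparableInRotated ψ (PHO.pho V)) ∧
    ((∃ ψ : ℝ, PHO.IsSeparableInRotated ψ (PHO.pho V)) →
      ∃! U : MvPolynomial (Fin 2) ℝ, U.IsHomogeneous (2 * δ - 2) ∧
        PHO.SharesBGNF (2 * δ - 2) (PHO.pho V : PHO.Series) (PHO.pho U : PHO.Series)) ∧
    (∀ U : MvPolynomial (Fin 2) ℝ, U.IsHomogeneous (2 * δ - 2) →
      PHO.SharesBGNF (2 * δ - 2) (PHO.pho V : PHO.Series) (PHO.pho U : PHO.Series) →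
        (∀ ψ : ℝ, PHO.IsSeparableInRotated ψ (PHO.pho V) →
          PHO.IsSeparableInRotated ψ (PHO.pho U)) ∧
        (V ≠ 0 → U ≠ 0)) := by
  obtain ⟨N, rfl⟩ : ∃ N, δ = N + 1 := ⟨δ - 1, by omega⟩
  have hN : Even N := by
    obtain ⟨k, hk⟩ := hodd
    exact ⟨k, by omega⟩
  have hN0 : N ≠ 0 := by omega
  rw [show 2 * (N + 1) - 2 = N + N by omega]
  have hex := fun ψ => PHO.exists_sharesBGNF_pho (ψ := ψ) hN hN0 hV
  have huniq := fun U U' => PHO.SharesBGNF.unique (U := U) (U' := U') hN hN0 hV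
  refine ⟨⟨?_, ?_⟩, ?_, fun U hU h => ⟨fun ψ hψ => ?_, fun hV0 => ?_⟩⟩
  · rintro ⟨U, hU, h⟩
    exact PHO.exists_isSeparableInRotated_of_sharesBGNF hN hN0 hV hU h
  · rintro ⟨ψ, hψ⟩
    obtain ⟨U, hU, h, -⟩ := hex ψ hψ
    exact ⟨U, hU, h⟩
  · rintro ⟨ψ, hψ⟩
    obtain ⟨U, hU, h, -⟩ := hex ψ hψ
    exact ⟨U, ⟨hU, h⟩, fun U' h' => huniq U' U h'.1 hU h'.2 h⟩
  · obtain ⟨U', hU', h', hs, -⟩ := hex ψ hψ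
    rwa [huniq U U' hU hU' h h']
  -- Necessity supplies an angle; the U constructed from it is nonzero, and by uniqueness it is the
  -- given one.
  · obtain ⟨ψ, hψ⟩ := PHO.exists_isSeparableInRotated_of_sharesBGNF hN hN0 hV hU h
    obtain ⟨U', hU', h', -, h0⟩ := hex ψ hψ
    rw [huniq U U' hU hU' h h']
    exact h0 hV0
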